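/- **Theorem 3.1 (error estimate).** Let $\lambda,\ell_1,\ell_2,\ell_3>0$. There is $\varepsilon>0$, depending only on $\lambda,\ell_1,\ell_2,\ell_3$, such that the following holds. Let $d>1$, let $\Omega\subset\mathbb R^d$ be open, bounded and connected, and let $T>0$. Let $\mathcal A:\mathbb R\times\mathbb R^d\to\mathbb R$ satisfy $|\mathcal A(r,p)-\mathcal A(s,q)|\le \ell_1(|r-s|+|p-q|)$, and let $g,f:\mathbb R\to\mathbb R$ be Lipschitz continuous with constants $\ell_2$ and $\ell_3$. Let $c_0\in L^2(\Omega)$, and let $\bar c\in L^2(0,T;H^1_0(\Omega))$ with $\partial_t\bar c\in L^2(0,T;H^{-1}(\Omega))$ be a weak solution, with $\bar c(0)=c_0$: for a.e. $t\in(0,T)$ and all $\varphi\in H_0^1(\Omega)$, $$\langle\partial_t\bar c(t),\varphi\rangle_{H^{-1},H^1_0}+\lambda\langle\nabla\bar c(t),\nabla\varphi\rangle+\langle\mathcal A(g(\bar c(t)),\nabla\bar c(t)),\varphi\rangle=\langle f(\bar c(t)),\varphi\rangle ,$$ where $\langle\cdot,\cdot\rangle$ is the scalar product of $L^2(\Omega)$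 or $L^2(\Omega)^d$. Suppose that $\bar c\in W^{1,\infty}(0,T;W^{2,\infty}(\Omega))$; its representative that is continuous in time is used (in particular $c_0=\bar c(0)\in L^\infty(\Omega)$). A *gradient discretisation* $\mathcal D$ consists of a finite dimensional real vector space $X_{\mathcal D,0}$, linear maps $\Pi_{\mathcal D}:X_{\mathcal D,0}\to L^2(\Omega)$ and $\nabla_{\mathcal D}:X_{\mathcal D,0}\to L^2(\Omega)^d$ such that $\|\nabla_{\mathcal D}\cdot\|_{L^2(\Omega)^d}$ is a norm, a continuous linear map $J_{\mathcal D}:L^\infty(\Omega)\to X_{\mathcal D,0}$, and times $0=t^{(0)}<\dots<t^{(N)}=T$. Put $\delta t^{(m+\frac12)}=t^{(m+1)}-t^{(m)}$, $\delta t=\max_m\delta t^{(m+\frac12)}$, $$C_{\mathcal D}=\max_{u\ne0}\frac{\|\Pi_{\mathcal D}u\|}{\|\nabla_{\mathcal D}u\|},\qquad S_{\mathcal D}(w)=\min_{u\in X_{\mathcal D,0}}\big(\|\Pi_{\mathcal D}u-w\|+\|\nabla_{\mathcal D}u-\nabla w\|\big)\quad(w\in H^1_0(\Omega)),$$ $$W_{\mathcal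 D}(\xi)=\max_{u\ne0}\frac{|\langle\nabla_{\mathcal D}u,\xi\rangle+\langle\Pi_{\mathcal D}u,\operatorname{div}\xi\rangle|}{\|\nabla_{\mathcal D}u\|}\quad(\xi\in L^2(\Omega)^d,\ \operatorname{div}\xi\in L^2(\Omega)).$$ Here all norms are those of $L^2(\Omega)$ or $L^2(\Omega)^d$, and a maximum over the empty set is $0$. The family $(c^{(m)})_{0\le m\le N}$ in $X_{\mathcal D,0}$ *solves the implicit gradient scheme* if $c^{(0)}=J_{\mathcal D}c_0$ and, for $0\le m<N$ and all $\varphi\in X_{\mathcal D,0}$, $$\Big\langle\frac{\Pi_{\mathcal D}c^{(m+1)}-\Pi_{\mathcal D}c^{(m)}}{\delta t^{(m+\frac12)}},\Pi_{\mathcal D}\varphi\Big\rangle+\lambda\langle\nabla_{\mathcal D}c^{(m+1)},\nabla_{\mathcal D}\varphi\rangle+\langle\mathcal A(g(\Pi_{\mathcal D}c^{(m+1)}),\nabla_{\mathcal D}c^{(m+1)}),\Pi_{\mathcal D}\varphi\rangle=\langle f(\Pi_{\mathcal D}c^{(m+1)}),\Pi_{\mathcal D}\varphi\rangle .$$ Let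 $\Pi_{\mathcal D}c$ and $\nabla_{\mathcal D}c$ be the functions of time equal to $\Pi_{\mathcal D}c^{(m+1)}$ and $\nabla_{\mathcal D}c^{(m+1)}$ on $(t^{(m)},t^{(m+1)}]$. Put $$\partial_t\bar c^{(m+1)}=\frac{\bar c(t^{(m+1)})-\bar c(t^{(m)})}{\delta t^{(m+\frac12)}},\qquad \nabla\bar c^{(m+1)}=\frac1{\delta t^{(m+\frac12)}}\int_{t^{(m)}}^{t^{(m+1)}}\nabla\bar c(t)\,dt,$$ $$\mathbb M_{\mathcal D}=\Big(\sum_{m=0}^{N-1}\delta t^{(m+\frac12)}\big[\delta t+S_{\mathcal D}(\bar c(t^{(m+1)}))+S_{\mathcal D}(\partial_t\bar c^{(m+1)})+W_{\mathcal D}(\nabla\bar c^{(m+1)})\big]^2\Big)^{1/2}.$$ Then there are constants $C_1,C_2>0$, independent of $\mathcal D$ and of the discrete solution, such that for every gradient discretisation $\mathcal D$ with $\delta t^{(m+\frac12)}<\frac{2\lambda}{C_{\mathcal D}+\varepsilon}$ for all $0\le m<N$ and every solution $c$ of the implicit gradient scheme, $$\|\Pi_{\mathcal D}c-\bar c\|_{L^\infty(0,T;L^2(\Omega))}\le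 C_1\big[\delta t+S_{\mathcal D}(\bar c(0))+\|c_0-\Pi_{\mathcal D}J_{\mathcal D}c_0\|+\mathbb M_{\mathcal D}\big]+\sqrt2\,S_{\mathcal D}(\bar c(t^{(k)}))\quad\text{for all }k\in\{1,\dots,N\},$$ $$\|\nabla_{\mathcal D}c-\nabla\bar c\|_{L^2(\Omega\times(0,T))^d}\le C_2\big[\delta t+S_{\mathcal D}(\bar c(0))+\|c_0-\Pi_{\mathcal D}J_{\mathcal D}c_0\|+\mathbb M_{\mathcal D}\big]+\sqrt2\sum_{m=0}^{N-1}\delta t^{(m+\frac12)}S_{\mathcal D}(\bar c(t^{(m+1)})).$$ -/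

import Mathlib

open MeasureTheory Set Filter Topology
open scoped ENNReal ContDiff

noncomputable section

namespace GDM

/-- The Euclidean space `ℝ^d`. -/
abbrev E (d : ℕ) : Type := EuclideanSpace ℝ (Fin d)

variable {d : ℕ}

/-- `L²(Ω)`. -/
abbrev L2 (Ω : Set (E d)) : Type := Lp ℝ 2 (volume.restrict Ω)

/-- `L²(Ω)^d`. -/
abbrev L2v (Ω : Set (E d)) : Type := Lp (E d) 2 (volume.restrict Ω)

/-- `L^∞(Ω)`. -/
abbrev Linf (Ω : Set (E d)) : Type := Lp ℝ ∞ (volume.restrict Ω)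

/-- Test functions: `φ ∈ C_c^∞(Ω)`. -/
structure IsTest (Ω : Set (E d)) (φ : E d → ℝ) : Prop where
  smooth : ContDiff ℝ ∞ φ
  compact : HasCompactSupport φ
  supp : tsupport φ ⊆ Ω

/-- `H_0^1(Ω)`, the closure of `C_c^∞(Ω)` for the `H^1` norm, as a subspace of
`L²(Ω) × L²(Ω)^d`: an element is a pair `(u, ∇u)`. The norm is the larger one of the two
`L²` norms, which is equivalent to the `H^1` norm. -/
def H10Submodule (Ω : Set (E d)) : Submodule ℝ (L2 Ω × L2v Ω) :=
  (Submodule.span ℝ {p : L2 Ω × L2v Ω | ∃ φ : E d → ℝ, IsTest Ω φ ∧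
    p.1 =ᵐ[volume.restrict Ω] φ ∧ p.2 =ᵐ[volume.restrict Ω] gradient φ}).topologicalClosure

/-- `H_0^1(Ω)` as a type. -/
def H10 (Ω : Set (E d)) : Type := H10Submodule Ω

instance (Ω : Set (E d)) : NormedAddCommGroup (H10 Ω) :=
  inferInstanceAs (NormedAddCommGroup (H10Submodule Ω))

instance (Ω : Set (E d)) : NormedSpace ℝ (H10 Ω) :=
  inferInstanceAs (NormedSpace ℝ (H10Submodule Ω))

/-- The inclusion of `H_0^1(Ω)` in `L²(Ω) × L²(Ω)^d`, `u ↦ (u, ∇u)`. -/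
def H10.incl (Ω : Set (E d)) : H10 Ω →L[ℝ] L2 Ω × L2v Ω := (H10Submodule Ω).subtypeL

/-- The function underlying an element of `H_0^1(Ω)`. -/
def H10.fn {Ω : Set (E d)} (u : H10 Ω) : L2 Ω := (H10.incl Ω u).1

/-- The gradient of an element of `H_0^1(Ω)`. -/
def H10.grad {Ω : Set (E d)} (u : H10 Ω) : L2v Ω := (H10.incl Ω u).2

/-- `H^{-1}(Ω)`, the topological dual of `H_0^1(Ω)`. -/
abbrev Hneg (Ω : Set (E d)) : Type := H10 Ω →L[ℝ] ℝ

/-- The embedding of `H_0^1(Ω)` in `H^{-1}(Ω)` by the scalar product of `L²(Ω)`: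
`u ↦ (φ ↦ ⟨u, φ⟩)`. -/
def H10.toHneg {Ω : Set (E d)} (u : H10 Ω) : Hneg Ω :=
  ((innerSL ℝ u.fn).comp (ContinuousLinearMap.fst ℝ (L2 Ω) (L2v Ω))).comp (H10.incl Ω)

/-- The Lebesgue measure on the time interval `(0,T)`. -/
abbrev timeMeasure (T : ℝ) : Measure ℝ := volume.restrict (Ioo 0 T)

/-- `v` is the weak derivative of `u` on `(0,T)`, with values in the Banach space `X`. -/
def IsWeakTimeDeriv {X : Type*} [NormedAddCommGroup X] [NormedSpace ℝ X]
    (T : ℝ) (u v : ℝ → X) : Prop :=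
  ∀ θ : ℝ → ℝ, ContDiff ℝ ∞ θ → HasCompactSupport θ → tsupport θ ⊆ Ioo 0 T →
    ∫ t, deriv θ t • u t ∂(timeMeasure T) = -∫ t, θ t • v t ∂(timeMeasure T)

/-- Weak solutions `c ∈ L²(0,T;H_0^1(Ω))`, `∂_t c ∈ L²(0,T;H^{-1}(Ω))` of
`∂_t c - λ Δc + A(g(c), ∇c) = f(c)` with `c(0) = c₀`.
As usual `c` stands for its representative that is continuous with values in `L²(Ω)`. -/
structure IsWeakSolution (Ω : Set (E d)) (T lam : ℝ) (A : ℝ → E d → ℝ) (g f : ℝ → ℝ)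
    (c₀ : L2 Ω) (c : ℝ → H10 Ω) : Prop where
  memLp : MemLp c 2 (timeMeasure T)
  continuousOn : ContinuousOn (fun t => (c t).fn) (Icc 0 T)
  initial : (c 0).fn = c₀
  equation : ∃ w : ℝ → Hneg Ω, MemLp w 2 (timeMeasure T) ∧
    IsWeakTimeDeriv T (fun t => (c t).toHneg) w ∧
    ∀ᵐ t ∂(timeMeasure T), ∀ φ : H10 Ω,
      w t φ + lam * inner ℝ (c t).grad φ.grad
        + ∫ x in Ω, A (g ((c t).fn x)) ((c t).grad x) * φ.fn x
      = ∫ x in Ω, f ((c t).fn x) * φ.fn x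

/-- The space `L^∞(Ω) × L^∞(Ω)^d × L^∞(Ω)^{d×d}` of candidates for `(u, ∇u, D²u)`. -/
abbrev Jet (Ω : Set (E d)) : Type :=
  Linf Ω × Lp (E d) ∞ (volume.restrict Ω) × Lp (E d →L[ℝ] E d) ∞ (volume.restrict Ω)

/-- `p = (u, ∇u, D²u)` in the sense of weak derivatives, so that `u ∈ W^{2,∞}(Ω)`;
the norm of `p` is the `W^{2,∞}(Ω)` norm of `u`. -/
def IsW2inf (Ω : Set (E d)) (p : Jet Ω) : Prop :=
  ∀ φ : E d → ℝ, IsTest Ω φ → ∀ e : E d,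
    (∫ x in Ω, p.1 x * fderiv ℝ φ x e = -∫ x in Ω, inner ℝ (p.2.1 x) e * φ x) ∧
    (∫ x in Ω, fderiv ℝ φ x e • p.2.1 x = -∫ x in Ω, φ x • p.2.2 x e)

/-- `c ∈ W^{1,∞}(0,T;W^{2,∞}(Ω))`: both `c` and its weak time derivative are in
`L^∞(0,T;W^{2,∞}(Ω))`. -/
def IsW1infW2inf (Ω : Set (E d)) (T : ℝ) (c : ℝ → H10 Ω) : Prop :=
  ∃ U V : ℝ → Jet Ω,
    MemLp U ∞ (timeMeasure T) ∧ MemLp V ∞ (timeMeasure T) ∧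
    (∀ᵐ t ∂(timeMeasure T), IsW2inf Ω (U t)) ∧
    (∀ᵐ t ∂(timeMeasure T), IsW2inf Ω (V t)) ∧
    IsWeakTimeDeriv T U V ∧
    ∀ᵐ t ∂(timeMeasure T), (U t).1 =ᵐ[volume.restrict Ω] (c t).fn

/-- `δ ∈ L²(Ω)` is the weak divergence of `ξ ∈ L²(Ω)^d`. -/
def IsWeakDiv {Ω : Set (E d)} (ξ : L2v Ω) (δ : L2 Ω) : Prop :=
  ∀ φ : E d → ℝ, IsTest Ω φ →
    ∫ x in Ω, inner ℝ (ξ x) (gradient φ x) = -∫ x in Ω, δ x * φ x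

open Classical in
/-- The weak divergence of `ξ ∈ H_div(Ω)` (and `0` if `ξ` has no divergence in `L²(Ω)`). -/
def weakDiv {Ω : Set (E d)} (ξ : L2v Ω) : L2 Ω :=
  if h : ∃ δ : L2 Ω, IsWeakDiv ξ δ then h.choose else 0

/-- A gradient discretisation on `Ω × (0,T)`. The norm of the finite dimensional space `X` is
`u ↦ ‖∇_D u‖`, and `interp` is continuous for it. -/
structure GradDisc (Ω : Set (E d)) (T : ℝ) where
  /-- the space of discrete unknowns -/
  X : Type
  [addCommGroup : AddCommGroup X]
  [module : Module ℝ X]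
  [finiteDimensional : FiniteDimensional ℝ X]
  /-- the function reconstruction `Π_D` -/
  recon : X →ₗ[ℝ] L2 Ω
  /-- the gradient reconstruction `∇_D` -/
  grad : X →ₗ[ℝ] L2v Ω
  grad_eq_zero : ∀ u : X, ‖grad u‖ = 0 → u = 0
  /-- the interpolation `J_D` of initial data -/
  interp : Linf Ω →ₗ[ℝ] X
  continuous_interp : Continuous fun v : Linf Ω => grad (interp v)
  /-- the number of time steps -/
  N : ℕ
  /-- the discrete times, of which `time 0, …, time N` are used -/
  time : ℕ → ℝ
  time_zero : time 0 = 0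
  time_lt : ∀ m < N, time m < time (m + 1)
  time_last : time N = T

attribute [instance] GradDisc.addCommGroup GradDisc.module GradDisc.finiteDimensional

namespace GradDisc

variable {Ω : Set (E d)} {T : ℝ} (D : GradDisc Ω T)

/-- The time step `δt^{(m+1/2)} = t^{(m+1)} - t^{(m)}`. -/
def dt (m : ℕ) : ℝ := D.time (m + 1) - D.time m

/-- The largest time step `δt`. -/
def dtMax : ℝ := ⨆ m : Fin D.N, D.dt m

/-- The coercivity constant `C_D`. -/
def CD : ℝ := sSup {r : ℝ | ∃ u : D.X, u ≠ 0 ∧ r = ‖D.recon u‖ / ‖D.grad u‖}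

/-- The consistency measure `S_D(w)`. -/
def SD (w : H10 Ω) : ℝ := ⨅ u : D.X, (‖D.recon u - w.fn‖ + ‖D.grad u - w.grad‖)

/-- The limit-conformity measure `W_D(ξ)`, for `ξ ∈ H_div(Ω)`. -/
def WD (ξ : L2v Ω) : ℝ :=
  sSup {r : ℝ | ∃ u : D.X, u ≠ 0 ∧
    r = |inner ℝ (D.grad u) ξ + inner ℝ (D.recon u) (weakDiv ξ)| / ‖D.grad u‖}

/-- The function of time that is equal to `v (m+1)` on `(t^{(m)}, t^{(m+1)}]`. -/
def stepFn {Y : Type*} [AddCommGroup Y] (v : ℕ → Y) (t : ℝ) : Y :=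
  ∑ m ∈ Finset.range D.N, (Ioc (D.time m) (D.time (m + 1))).indicator (fun _ => v (m + 1)) t

/-- `(c^{(m)})_{0 ≤ m ≤ N}` solves the implicit gradient scheme with initial datum `c₀`. -/
structure IsSchemeSolution (lam : ℝ) (A : ℝ → E d → ℝ) (g f : ℝ → ℝ)
    (c₀ : Linf Ω) (c : ℕ → D.X) : Prop where
  initial : c 0 = D.interp c₀
  step : ∀ m < D.N, ∀ φ : D.X,
    inner ℝ ((D.dt m)⁻¹ • (D.recon (c (m + 1)) - D.recon (c m))) (D.recon φ)
      + lam * inner ℝ (D.grad (c (m + 1))) (D.grad φ)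
      + ∫ x in Ω, A (g (D.recon (c (m + 1)) x)) (D.grad (c (m + 1)) x) * D.recon φ x
    = ∫ x in Ω, f (D.recon (c (m + 1)) x) * D.recon φ x

/-- The difference quotient `∂_t c^{(m+1)} = (c(t^{(m+1)}) - c(t^{(m)})) / δt^{(m+1/2)}`. -/
def diffQuot (c : ℝ → H10 Ω) (m : ℕ) : H10 Ω :=
  (D.dt m)⁻¹ • (c (D.time (m + 1)) - c (D.time m))

/-- `∇c^{(m+1)}`, the mean of `∇c` over `(t^{(m)}, t^{(m+1)})`. -/
def avgGrad (c : ℝ → H10 Ω) (m : ℕ) : L2v Ω :=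
  (D.dt m)⁻¹ • ∫ t in D.time m..D.time (m + 1), (c t).grad

/-- The discrete `L²(0,T)` norm of
`δt + S_D(c(t^{(m+1)})) + S_D(∂_t c^{(m+1)}) + W_D(∇c^{(m+1)})`. -/
def MD (c : ℝ → H10 Ω) : ℝ :=
  Real.sqrt (∑ m ∈ Finset.range D.N, D.dt m *
    (D.dtMax + D.SD (c (D.time (m + 1))) + D.SD (D.diffQuot c m) + D.WD (D.avgGrad c m)) ^ 2)

end GradDisc

end GDM

end

/-! The proof is an energy argument for the distance between the discrete solution and a discrete
interpolant of the exact one. Write F(u, p) = A(g(u), p) - f(u), which is Lipschitz from L² × L² to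
L² (`exists_nemytskii`).

Two facts about the exact solution are needed. First, it is Lipschitz in time with values in H¹₀
(`IsW1infW2inf.exists_lipschitz`): it is a primitive of a bounded function at almost all times, and
continuity in L² carries the estimate to all times. Replacing averages over a time step by values at
its right end therefore costs O(δt). Second, the equation averaged over a step shows that λ times
the divergence of the mean gradient is the difference quotient plus the mean of F
(`IsWeakSolution.isWeakDiv_average`). The mean gradient is thus an admissible argument of W_D, with
a known divergence.

The interpolants P are built by interpolating the initial value and each difference quotient, and
then summing in time (`GradDisc.exists_interpolants`). Their discrete time derivative is then
consistent by construction, and their own error is controlled by S_D of the initial value, δt and √T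
times M_D. Testing the scheme with c - P leaves four defects: time derivative, gradient,
nonlinearity and limit conformity (`GradDisc.IsSchemeSolution.residual_le`). Young's inequality
hides the gradient terms in the diffusion, and an implicit Gronwall inequality bounds both the L²
error and the accumulated gradient error (`GradDisc.IsSchemeSolution.error_estimate`). The triangle
inequality finishes the proof. The terms with √2 S_D in the theorem are nonnegative and only enlarge
the bounds obtained. -/

namespace GDM

/-! ### Primitives of weak time derivatives -/

/-- The primitive of a normalised bump function centred at `0`, a smoothed step. -/
noncomputable def smoothStep (φ : ContDiffBump (0 : ℝ)) (x : ℝ) : ℝ :=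
  ∫ s in (-1 : ℝ)..x, φ.normed volume s

section SmoothStep

variable (φ : ContDiffBump (0 : ℝ))

lemma hasDerivAt_smoothStep (x : ℝ) : HasDerivAt (smoothStep φ) (φ.normed volume x) x :=
  (φ.continuous_normed (μ := volume)).integral_hasStrictDerivAt (-1) x |>.hasDerivAt

lemma contDiff_smoothStep : ContDiff ℝ ∞ (smoothStep φ) := by
  rw [contDiff_infty_iff_deriv]
  refine ⟨fun x => (hasDerivAt_smoothStep φ x).differentiableAt, ?_⟩
  rw [show deriv (smoothStep φ) = φ.normed volume from
    funext fun x => (hasDerivAt_smoothStep φ x).deriv]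
  exact φ.contDiff_normed

lemma abs_smoothStep_le (x : ℝ) : |smoothStep φ x| ≤ 1 := by
  have h := intervalIntegral.norm_integral_le_integral_norm_uIoc (μ := volume)
    (a := -1) (b := x) (f := φ.normed volume)
  refine h.trans ?_
  rw [← φ.integral_normed (μ := volume)]
  have h2 : ∀ s, ‖φ.normed volume s‖ = φ.normed volume s := fun s =>
    Real.norm_of_nonneg (φ.nonneg_normed s)
  simp only [h2]
  exact setIntegral_le_integral φ.integrable_normed
    (Eventually.of_forall fun s => φ.nonneg_normed s)

lemma normed_eq_zero_of_rOut_le {s : ℝ} (hs : φ.rOut ≤ |s|) : φ.normed volume s = 0 := by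
  have : s ∉ Function.support (φ.normed volume) := by
    rw [φ.support_normed_eq]
    simpa using hs
  simpa using this

/-- The bound on the outer radius puts the base point -1 of the primitive to the left of the bump,
so nothing is integrated, even when x lies below -1. -/
lemma smoothStep_of_le (hφ : φ.rOut ≤ 1) {x : ℝ} (hx : x ≤ -φ.rOut) : smoothStep φ x = 0 := by
  unfold smoothStep
  refine intervalIntegral.integral_zero_ae (Eventually.of_forall fun s hs => ?_)
  refine normed_eq_zero_of_rOut_le φ ?_
  have hs2 : s ≤ max (-1) x := hs.2
  have : s ≤ -φ.rOut := hs2.trans (max_le (by linarith) hx)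
  rw [abs_of_nonpos (by linarith [φ.rOut_pos])]
  linarith

lemma smoothStep_of_ge (hφ : φ.rOut ≤ 1) {x : ℝ} (hx : φ.rOut ≤ x) : smoothStep φ x = 1 := by
  unfold smoothStep
  rw [intervalIntegral.integral_eq_integral_of_support_subset, φ.integral_normed]
  rw [φ.support_normed_eq, Real.ball_eq_Ioo]
  intro s hs
  exact ⟨by linarith [hs.1], by linarith [hs.2]⟩

end SmoothStep

/-- A weakly differentiable function is a.e. the primitive of its weak derivative. -/
lemma IsWeakTimeDeriv.exists_integral_eq_sub {X : Type*} [NormedAddCommGroup X] [NormedSpace ℝ X]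
    [CompleteSpace X] {T : ℝ} {u v : ℝ → X} (h : IsWeakTimeDeriv T u v)
    (hu : Integrable u (timeMeasure T)) (hv : Integrable v (timeMeasure T)) :
    ∃ s : Set ℝ, s ⊆ Ioo 0 T ∧ (∀ᵐ t ∂(timeMeasure T), t ∈ s) ∧
      ∀ a ∈ s, ∀ b ∈ s, ∫ t in a..b, v t = u b - u a := by
  -- The radii shrink to 0 with constant ratio 2; a bounded ratio is what makes the mollifications
  -- converge almost everywhere.
  let φ : ℕ → ContDiffBump (0 : ℝ) := fun n =>
    ⟨1 / (2 * (n + 1)), 1 / (n + 1), by positivity, by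
      apply one_div_lt_one_div_of_lt <;> linarith [(n.cast_nonneg : (0 : ℝ) ≤ n)]⟩
  have hφ : Tendsto (fun n => (φ n).rOut) atTop (𝓝 0) := tendsto_one_div_add_atTop_nhds_zero_nat
  have hφ1 : ∀ n, (φ n).rOut ≤ 1 := fun n => by
    change 1 / ((n : ℝ) + 1) ≤ 1
    rw [div_le_one (by positivity)]; linarith [(n.cast_nonneg : (0 : ℝ) ≤ n)]
  have hφK : ∀ᶠ n in atTop, (φ n).rOut ≤ 2 * (φ n).rIn := Eventually.of_forall fun n => by
    change 1 / ((n : ℝ) + 1) ≤ 2 * (1 / (2 * (n + 1)))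
    apply le_of_eq; field_simp
  let U : ℝ → X := (Ioo 0 T).indicator u
  have hU : Integrable U := (integrable_indicator_iff measurableSet_Ioo).2 hu
  have hconv := ContDiffBump.ae_convolution_tendsto_right_of_locallyIntegrable (μ := volume)
    hφ hφK hU.locallyIntegrable
  let s : Set ℝ := {x | x ∈ Ioo 0 T ∧
    Tendsto (fun n => ∫ t, (φ n).normed volume (t - x) • U t) atTop (𝓝 (U x))}
  have key : ∀ a ∈ s, ∀ b ∈ s, a < b → ∫ t in a..b, v t = u b - u a := by
    rintro a ⟨ha, hca⟩ b ⟨hb, hcb⟩ hab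
    -- A smooth version of minus the indicator of (a, b]: its derivative approximates δ_b - δ_a, so
    -- the weak formulation tends to the fundamental theorem of calculus.
    let θ : ℕ → ℝ → ℝ := fun n t => smoothStep (φ n) (t - b) - smoothStep (φ n) (t - a)
    have hθd : ∀ n t, deriv (θ n) t = (φ n).normed volume (t - b) - (φ n).normed volume (t - a) := by
      intro n t
      exact ((hasDerivAt_smoothStep (φ n) (t - b)).comp_sub_const t b |>.sub
        ((hasDerivAt_smoothStep (φ n) (t - a)).comp_sub_const t a)).deriv
    have hθs : ∀ n, ContDiff ℝ ∞ (θ n) := fun n =>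
      ((contDiff_smoothStep (φ n)).comp (contDiff_id.sub contDiff_const)).sub
        ((contDiff_smoothStep (φ n)).comp (contDiff_id.sub contDiff_const))
    have hθ0 : ∀ n t, t ∉ Icc (a - (φ n).rOut) (b + (φ n).rOut) → θ n t = 0 := by
      intro n t ht
      simp only [θ]
      rw [mem_Icc, not_and_or, not_le, not_le] at ht
      rcases ht with ht | ht
      · rw [smoothStep_of_le _ (hφ1 n) (by linarith), smoothStep_of_le _ (hφ1 n) (by linarith),
          sub_zero]
      · rw [smoothStep_of_ge _ (hφ1 n) (by linarith), smoothStep_of_ge _ (hφ1 n) (by linarith),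
          sub_self]
    have hsupp : ∀ n, tsupport (θ n) ⊆ Icc (a - (φ n).rOut) (b + (φ n).rOut) := fun n =>
      closure_minimal (fun t ht => by by_contra hc; exact ht (hθ0 n t hc)) isClosed_Icc
    have hev : ∀ᶠ n in atTop, ∫ t, deriv (θ n) t • u t ∂(timeMeasure T)
        = -∫ t, θ n t • v t ∂(timeMeasure T) := by
      have h1 : ∀ᶠ n in atTop, (φ n).rOut < a := hφ.eventually_lt_const ha.1
      have h2 : ∀ᶠ n in atTop, (φ n).rOut < T - b := hφ.eventually_lt_const (by linarith [hb.2])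
      filter_upwards [h1, h2] with n hn1 hn2
      refine h (θ n) (hθs n) (HasCompactSupport.of_support_subset_isCompact isCompact_Icc
        (subset_closure.trans (hsupp n))) ((hsupp n).trans fun t ht => ?_)
      exact ⟨by linarith [ht.1], by linarith [ht.2]⟩
    have hlim1 : Tendsto (fun n => ∫ t, deriv (θ n) t • u t ∂(timeMeasure T)) atTop
        (𝓝 (u b - u a)) := by
      have hUa : U a = u a := indicator_of_mem ha _
      have hUb : U b = u b := indicator_of_mem hb _
      have := hcb.sub hca
      rw [hUa, hUb] at this
      refine this.congr fun n => ?_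
      have hi : ∀ x, Integrable (fun t => (φ n).normed volume (t - x) • U t) := fun x => by
        refine hU.bdd_smul (1 / (volume.real (Metric.closedBall (0 : ℝ) (φ n).rIn)))
          (((φ n).continuous_normed).comp
            (continuous_sub_right x)).aestronglyMeasurable
          (Eventually.of_forall fun t => ?_)
        rw [Real.norm_of_nonneg ((φ n).nonneg_normed _)]
        exact (φ n).normed_le_div_measure_closedBall_rIn _ _
      rw [← integral_sub (hi b) (hi a), ← integral_indicator measurableSet_Ioo]
      refine integral_congr_ae (Eventually.of_forall fun t => ?_)
      simp only [U]
      by_cases ht : t ∈ Ioo 0 T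
      · simp [ht, hθd, sub_smul]
      · simp [ht]
    have hlim2 : Tendsto (fun n => ∫ t, θ n t • v t ∂(timeMeasure T)) atTop
        (𝓝 (∫ t, (Ioc a b).indicator (fun t => -v t) t ∂(timeMeasure T))) := by
      refine tendsto_integral_of_dominated_convergence (fun t => 2 * ‖v t‖)
        (fun n => ((hθs n).continuous.aestronglyMeasurable).smul hv.aestronglyMeasurable)
        (hv.norm.const_mul 2) (fun n => Eventually.of_forall fun t => ?_) ?_
      · rw [norm_smul]
        gcongr
        calc ‖θ n t‖ ≤ |smoothStep (φ n) (t - b)| + |smoothStep (φ n) (t - a)| := abs_sub _ _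
          _ ≤ 2 := by linarith [abs_smoothStep_le (φ n) (t - b), abs_smoothStep_le (φ n) (t - a)]
      · have hna : ∀ᵐ t ∂(timeMeasure T), t ≠ a := ae_restrict_of_ae (Measure.ae_ne volume a)
        have hnb : ∀ᵐ t ∂(timeMeasure T), t ≠ b := ae_restrict_of_ae (Measure.ae_ne volume b)
        filter_upwards [hna, hnb] with t hta htb
        refine tendsto_const_nhds.congr' ?_
        have h1 : ∀ᶠ n in atTop, (φ n).rOut < |t - a| :=
          hφ.eventually_lt_const (abs_pos.2 (sub_ne_zero.2 hta))
        have h2 : ∀ᶠ n in atTop, (φ n).rOut < |t - b| :=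
          hφ.eventually_lt_const (abs_pos.2 (sub_ne_zero.2 htb))
        filter_upwards [h1, h2] with n hn1 hn2
        simp only [θ]
        rcases lt_or_gt_of_ne hta with hta | hta
        · rw [abs_of_neg (by linarith)] at hn1 hn2
          rw [smoothStep_of_le _ (hφ1 n) (by linarith), smoothStep_of_le _ (hφ1 n) (by linarith),
            indicator_of_notMem (fun hh => by linarith [hh.1])]
          simp
        · rw [abs_of_pos (by linarith)] at hn1
          rw [smoothStep_of_ge _ (hφ1 n) (x := t - a) (by linarith)]
          rcases lt_or_gt_of_ne htb with htb | htb
          · rw [abs_of_neg (by linarith)] at hn2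
            rw [smoothStep_of_le _ (hφ1 n) (by linarith), indicator_of_mem (show t ∈ Ioc a b from ⟨hta, htb.le⟩)]
            simp
          · rw [abs_of_pos (by linarith)] at hn2
            rw [smoothStep_of_ge _ (hφ1 n) (by linarith),
              indicator_of_notMem (fun hh => by linarith [hh.2])]
            simp
    have hfin := tendsto_nhds_unique_of_eventuallyEq hlim1 hlim2.neg hev
    rw [hfin, integral_indicator measurableSet_Ioc, integral_neg, neg_neg,
      Measure.restrict_restrict measurableSet_Ioc, intervalIntegral.integral_of_le hab.le,
      inter_eq_left.2 (show Ioc a b ⊆ Ioo 0 T from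
        fun t ht => ⟨ha.1.trans ht.1, ht.2.trans_lt hb.2⟩)]
  refine ⟨s, fun x hx => hx.1, ?_, fun a ha b hb => ?_⟩
  · filter_upwards [ae_restrict_mem measurableSet_Ioo, ae_restrict_of_ae hconv] with x hx hcx
    refine ⟨hx, hcx.congr fun n => ?_⟩
    rw [convolution_def, ← integral_sub_left_eq_self (fun t => (φ n).normed volume (t - x) • U t)
      volume x]
    refine integral_congr_ae (Eventually.of_forall fun t => ?_)
    simp [(φ n).normed_neg]
  · rcases lt_trichotomy a b with hab | hab | hab
    · exact key a ha b hb hab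
    · subst hab; simp
    · rw [intervalIntegral.integral_symm, key b hb a ha hab, neg_sub]

/-- A point of `[0,T]` is a limit of points of a set of full measure in `(0,T)`. -/
lemma nhdsWithin_neBot_of_ae_mem {T : ℝ} (hT : 0 < T) {s : Set ℝ}
    (hs : ∀ᵐ t ∂(timeMeasure T), t ∈ s) {t : ℝ} (ht : t ∈ Icc 0 T) : (𝓝[s] t).NeBot := by
  rw [← mem_closure_iff_nhdsWithin_neBot]
  have h1 : Ioo 0 T ⊆ closure s := by
    intro x hx
    rw [_root_.mem_closure_iff]
    intro o ho hxo
    by_contra hne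
    rw [not_nonempty_iff_eq_empty] at hne
    have hz : volume (o ∩ Ioo 0 T) = 0 := by
      have h2 := (ae_restrict_iff' measurableSet_Ioo).1 hs
      refine measure_mono_null (fun y hy => ?_) h2
      intro hc
      have : y ∈ o ∩ s := ⟨hy.1, hc hy.2⟩
      rw [hne] at this
      exact this
    exact (ho.inter isOpen_Ioo).measure_ne_zero volume ⟨x, hxo, hx⟩ hz
  have := closure_minimal h1 isClosed_closure
  rw [closure_Ioo hT.ne] at this
  exact this ht

end GDM

/-! ### Linear images of weak derivatives, and the embedding of L^∞ in L² -/

namespace GDM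

variable {d : ℕ}

section WeakTimeDeriv

variable {X Y : Type*} [NormedAddCommGroup X] [NormedSpace ℝ X]
  [NormedAddCommGroup Y] [NormedSpace ℝ Y] {T : ℝ} {u v : ℝ → X}

lemma integrable_smul_of_hasCompactSupport {θ : ℝ → ℝ} (hθ : Continuous θ)
    (hc : HasCompactSupport θ) (hu : Integrable u (timeMeasure T)) :
    Integrable (fun t => θ t • u t) (timeMeasure T) := by
  obtain ⟨C, hC⟩ := hc.exists_bound_of_continuous hθ
  exact hu.bdd_smul C hθ.aestronglyMeasurable (Eventually.of_forall hC)

/-- Bounded operators commute with the Bochner integral. This carries jets to L² × L²^d and turns an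
equation in H⁻¹ into scalar ones. -/
lemma IsWeakTimeDeriv.clm_comp [CompleteSpace X] [CompleteSpace Y] (h : IsWeakTimeDeriv T u v)
    (hu : Integrable u (timeMeasure T)) (hv : Integrable v (timeMeasure T)) (L : X →L[ℝ] Y) :
    IsWeakTimeDeriv T (fun t => L (u t)) (fun t => L (v t)) := by
  intro θ h1 h2 h3
  have := congrArg L (h θ h1 h2 h3)
  rw [map_neg, ← L.integral_comp_comm, ← L.integral_comp_comm] at this
  · simpa only [map_smul] using this
  · exact integrable_smul_of_hasCompactSupport h1.continuous h2 hv
  · exact integrable_smul_of_hasCompactSupport (h1.continuous_deriv (by simp)) h2.deriv hu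

end WeakTimeDeriv

section LinfToL2

variable {α F : Type*} [MeasurableSpace α] {μ : Measure α} [IsFiniteMeasure μ]
  [NormedAddCommGroup F] [NormedSpace ℝ F]

/-- The embedding `L^∞ → L²` on a space of finite measure. -/
noncomputable def linfToL2 : Lp F ∞ μ →L[ℝ] Lp F 2 μ :=
  LinearMap.mkContinuous
    { toFun := fun f => ((Lp.memLp f).mono_exponent le_top).toLp f
      map_add' := fun f g => by
        ext1
        filter_upwards [MemLp.coeFn_toLp ((Lp.memLp (f + g)).mono_exponent (p := 2) le_top),
          MemLp.coeFn_toLp ((Lp.memLp f).mono_exponent (p := 2) le_top),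
          MemLp.coeFn_toLp ((Lp.memLp g).mono_exponent (p := 2) le_top),
          Lp.coeFn_add f g, Lp.coeFn_add (((Lp.memLp f).mono_exponent (p := 2) le_top).toLp f)
            (((Lp.memLp g).mono_exponent (p := 2) le_top).toLp g)] with x h1 h2 h3 h4 h5
        exact h1.trans (h4.trans (by rw [Pi.add_apply, ← h2, ← h3]; exact h5.symm))
      map_smul' := fun c f => by
        ext1
        filter_upwards [MemLp.coeFn_toLp ((Lp.memLp (c • f)).mono_exponent (p := 2) le_top),
          MemLp.coeFn_toLp ((Lp.memLp f).mono_exponent (p := 2) le_top),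
          Lp.coeFn_smul c f,
          Lp.coeFn_smul c (((Lp.memLp f).mono_exponent (p := 2) le_top).toLp f)] with x h1 h2 h3 h4
        simp [h1, h2, h3, h4] }
    ((μ univ ^ (1 / (2 : ℝ≥0∞).toReal)).toReal) fun f => by
      change ‖MemLp.toLp f ((Lp.memLp f).mono_exponent (p := 2) le_top)‖ ≤ _
      rw [Lp.norm_toLp, Lp.norm_def, ← ENNReal.toReal_mul, mul_comm]
      refine ENNReal.toReal_mono ?_ ?_
      · exact ENNReal.mul_ne_top (Lp.eLpNorm_ne_top f)
          (ENNReal.rpow_ne_top_of_nonneg (by simp) (measure_ne_top μ univ))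
      · have := eLpNorm_le_eLpNorm_mul_rpow_measure_univ (μ := μ) (p := 2) (q := ∞) le_top
          (Lp.aestronglyMeasurable f)
        simpa using this

lemma coeFn_linfToL2 (f : Lp F ∞ μ) : linfToL2 f =ᵐ[μ] f :=
  MemLp.coeFn_toLp ((Lp.memLp f).mono_exponent (p := 2) le_top)

end LinfToL2

/-! ### Weak gradients in H¹₀ and Lipschitz continuity in time -/

section Sobolev

variable {Ω : Set (E d)}

lemma IsTest.memLp_fderiv {φ : E d → ℝ} (hφ : IsTest Ω φ) (e : E d) :
    MemLp (fun x => fderiv ℝ φ x e) 2 (volume.restrict Ω) :=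
  ((hφ.smooth.continuous_fderiv (by simp)).clm_apply continuous_const).memLp_of_hasCompactSupport
    (hφ.compact.fderiv_apply ℝ e)

lemma IsTest.memLp {φ : E d → ℝ} (hφ : IsTest Ω φ) : MemLp φ 2 (volume.restrict Ω) :=
  hφ.smooth.continuous.memLp_of_hasCompactSupport hφ.compact

lemma IsTest.memLp_smul {φ : E d → ℝ} (hφ : IsTest Ω φ) (e : E d) :
    MemLp (fun x => φ x • e) 2 (volume.restrict Ω) :=
  (hφ.smooth.continuous.smul continuous_const).memLp_of_hasCompactSupport
    hφ.compact.smul_right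

lemma IsTest.memLp_gradient {φ : E d → ℝ} (hφ : IsTest Ω φ) :
    MemLp (gradient φ) 2 (volume.restrict Ω) := by
  have hc : Continuous (gradient φ) :=
    (InnerProductSpace.toDual ℝ (E d)).symm.continuous.comp
      (hφ.smooth.continuous_fderiv (by simp))
  refine hc.memLp_of_hasCompactSupport ?_
  exact (hφ.compact.fderiv ℝ).comp_left (g := (InnerProductSpace.toDual ℝ (E d)).symm) (map_zero _)

lemma IsTest.setIntegral_eq {F : Type*} [NormedAddCommGroup F] [NormedSpace ℝ F]
    {φ : E d → ℝ} (hφ : IsTest Ω φ) {h : E d → F} (hh : ∀ x, x ∉ tsupport φ → h x = 0) :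
    ∫ x in Ω, h x = ∫ x, h x :=
  setIntegral_eq_integral_of_forall_compl_eq_zero fun x hx => hh x fun hc => hx (hφ.supp hc)

/-- Integration by parts for functions in `H_0^1(Ω)`. -/
lemma H10.integral_mul_fderiv (u : H10 Ω) {ψ : E d → ℝ} (hψ : IsTest Ω ψ) (e : E d) :
    ∫ x in Ω, u.fn x * fderiv ℝ ψ x e = -∫ x in Ω, inner ℝ (u.grad x) e * ψ x := by
  -- The defect in the formula is a continuous functional of the pair (u, ∇u). Its kernel is closed
  -- and contains the test functions, hence all of H¹₀.
  let Λ : L2 Ω × L2v Ω →L[ℝ] ℝ :=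
    (innerSL ℝ (hψ.memLp_fderiv e).toLp).comp (ContinuousLinearMap.fst ℝ _ _) +
    (innerSL ℝ (hψ.memLp_smul e).toLp).comp (ContinuousLinearMap.snd ℝ _ _)
  have hΛ : ∀ p : L2 Ω × L2v Ω, Λ p = (∫ x in Ω, p.1 x * fderiv ℝ ψ x e) +
      ∫ x in Ω, inner ℝ (p.2 x) e * ψ x := by
    intro p
    change inner ℝ _ p.1 + inner ℝ _ p.2 = _
    rw [L2.inner_def, L2.inner_def]
    congr 1
    · refine integral_congr_ae ?_
      filter_upwards [(hψ.memLp_fderiv e).coeFn_toLp] with x hx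
      rw [hx]; simp
    · refine integral_congr_ae ?_
      filter_upwards [(hψ.memLp_smul e).coeFn_toLp] with x hx
      rw [hx, real_inner_smul_left, real_inner_comm, mul_comm]
  have hle : H10Submodule Ω ≤ LinearMap.ker Λ.toLinearMap := by
    refine Submodule.topologicalClosure_minimal _ (Submodule.span_le.2 ?_) Λ.isClosed_ker
    rintro p ⟨φ, hφ, h1, h2⟩
    change Λ p = 0
    rw [hΛ]
    have e1 : ∫ x in Ω, p.1 x * fderiv ℝ ψ x e = ∫ x, φ x * fderiv ℝ ψ x e := by
      rw [← hφ.setIntegral_eq fun x hx => by rw [image_eq_zero_of_notMem_tsupport hx, zero_mul]]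
      refine integral_congr_ae ?_
      filter_upwards [h1] with x hx
      rw [hx]
    have e2 : ∫ x in Ω, inner ℝ (p.2 x) e * ψ x = ∫ x, fderiv ℝ φ x e * ψ x := by
      rw [← hψ.setIntegral_eq fun x hx => by rw [image_eq_zero_of_notMem_tsupport hx, mul_zero]]
      refine integral_congr_ae ?_
      filter_upwards [h2] with x hx
      rw [hx, gradient, InnerProductSpace.toDual_symm_apply]
    have cφ := hφ.smooth.continuous
    have cψ := hψ.smooth.continuous
    have dφ : Continuous fun x => fderiv ℝ φ x e :=
      (hφ.smooth.continuous_fderiv (by simp)).clm_apply continuous_const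
    have dψ : Continuous fun x => fderiv ℝ ψ x e :=
      (hψ.smooth.continuous_fderiv (by simp)).clm_apply continuous_const
    rw [e1, e2, integral_mul_fderiv_eq_neg_fderiv_mul_of_integrable, neg_add_cancel]
    · exact (dφ.mul cψ).integrable_of_hasCompactSupport hψ.compact.mul_left
    · exact (cφ.mul dψ).integrable_of_hasCompactSupport hφ.compact.mul_right
    · exact (cφ.mul cψ).integrable_of_hasCompactSupport hφ.compact.mul_right
    · exact fun x _ => hφ.smooth.differentiable (by simp) x
    · exact fun x _ => hψ.smooth.differentiable (by simp) x
  have h0 : Λ (H10.incl Ω u) = 0 := hle u.2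
  rw [hΛ] at h0
  exact eq_neg_of_add_eq_zero_left h0

/-- An integrable function that is orthogonal to all test functions vanishes. -/
lemma ae_eq_zero_of_forall_isTest {F : Type*} [NormedAddCommGroup F] [NormedSpace ℝ F]
    [CompleteSpace F] (hΩ : IsOpen Ω) {h : E d → F} (hh : Integrable h (volume.restrict Ω))
    (h0 : ∀ φ, IsTest Ω φ → ∫ x in Ω, φ x • h x = 0) : h =ᵐ[volume.restrict Ω] 0 := by
  have := hΩ.ae_eq_zero_of_integral_contDiff_smul_eq_zero (f := h) (μ := volume)
    (IntegrableOn.locallyIntegrableOn hh) (fun g h1 h2 h3 => by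
      have ht : IsTest Ω g := ⟨h1, h2, h3⟩
      rw [← ht.setIntegral_eq fun x hx => by rw [image_eq_zero_of_notMem_tsupport hx, zero_smul]]
      exact h0 g ht)
  exact (ae_restrict_iff' hΩ.measurableSet).2 this

variable [IsFiniteMeasure (volume.restrict Ω)]

/-- The gradient of an element of `H_0^1(Ω)` is determined by its action on test functions. -/
lemma H10.grad_ae_eq (hΩ : IsOpen Ω) (u : H10 Ω) {G : E d → E d}
    (hG : MemLp G 2 (volume.restrict Ω))
    (h : ∀ φ, IsTest Ω φ → ∀ e : E d,
      ∫ x in Ω, u.fn x * fderiv ℝ φ x e = -∫ x in Ω, inner ℝ (G x) e * φ x) :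
    u.grad =ᵐ[volume.restrict Ω] G := by
  have hc : ∀ i : Fin d, (fun x => inner ℝ (u.grad x - G x) (EuclideanSpace.single i (1 : ℝ)))
      =ᵐ[volume.restrict Ω] 0 := by
    intro i
    have hm : ∀ {H : E d → E d}, MemLp H 2 (volume.restrict Ω) →
        MemLp (fun x => inner ℝ (H x) (EuclideanSpace.single i (1 : ℝ))) 2 (volume.restrict Ω) :=
      fun hH => hH.inner_const _
    have hm1 := hm (Lp.memLp u.grad)
    have hm2 := hm hG
    refine ae_eq_zero_of_forall_isTest hΩ ?_ ?_
    · exact (hm ((Lp.memLp u.grad).sub hG)).integrable (by norm_num)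
    · intro φ hφ
      have h1 := u.integral_mul_fderiv hφ (EuclideanSpace.single i (1 : ℝ))
      rw [h φ hφ, neg_inj] at h1
      simp only [smul_eq_mul, inner_sub_left, mul_sub]
      have i1 : Integrable (fun x => φ x * inner ℝ (u.grad x) (EuclideanSpace.single i (1 : ℝ)))
        (volume.restrict Ω) := hφ.memLp.integrable_mul hm1
      have i2 : Integrable (fun x => φ x * inner ℝ (G x) (EuclideanSpace.single i (1 : ℝ)))
        (volume.restrict Ω) := hφ.memLp.integrable_mul hm2
      rw [integral_sub i1 i2]
      simp only [mul_comm (φ _)]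
      rw [h1, sub_self]
  filter_upwards [ae_all_iff.2 hc] with x hx
  rw [← sub_eq_zero]
  ext i
  simpa [EuclideanSpace.inner_single_right] using hx i

/-- Elements are pairs, but the second component is a weak gradient of the first, and weak gradients
are unique. -/
lemma H10.ext_fn (hΩ : IsOpen Ω) {u v : H10 Ω} (h : u.fn = v.fn) : u = v := by
  have hg : u.grad = v.grad := by
    ext1
    refine u.grad_ae_eq hΩ (Lp.memLp _) fun φ hφ e => ?_
    rw [h, v.integral_mul_fderiv hφ e]
  exact Subtype.ext (Prod.ext h hg)

/-- The embedding of the jets `(u, ∇u, D²u)` in `L²(Ω) × L²(Ω)^d`. -/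
noncomputable def jetToL2 (Ω : Set (E d)) [IsFiniteMeasure (volume.restrict Ω)] : Jet Ω →L[ℝ] L2 Ω × L2v Ω :=
  (linfToL2.comp (ContinuousLinearMap.fst ℝ _ _)).prod
    (linfToL2.comp ((ContinuousLinearMap.fst ℝ _ _).comp (ContinuousLinearMap.snd ℝ _ _)))

/-- Uniqueness of weak gradients again: this transfers time regularity of the jets to the solution
in H¹₀. -/
lemma H10.incl_eq_jetToL2 (hΩ : IsOpen Ω) {u : H10 Ω} {p : Jet Ω} (hp : IsW2inf Ω p)
    (h : p.1 =ᵐ[volume.restrict Ω] u.fn) : H10.incl Ω u = jetToL2 Ω p := by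
  refine Prod.ext ?_ ?_
  · change u.fn = linfToL2 p.1
    ext1
    exact h.symm.trans (coeFn_linfToL2 _).symm
  · change u.grad = linfToL2 p.2.1
    ext1
    refine EventuallyEq.trans ?_ (coeFn_linfToL2 _).symm
    refine u.grad_ae_eq hΩ ((Lp.memLp _).mono_exponent le_top) fun φ hφ e => ?_
    rw [← (hp φ hφ e).1]
    refine integral_congr_ae ?_
    filter_upwards [h] with x hx
    rw [hx]

/-- The representative of a function in `W^{1,∞}(0,T;W^{2,∞}(Ω))` that is continuous with values
in `L²(Ω)` is Lipschitz continuous with values in `H_0^1(Ω)`. -/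
lemma IsW1infW2inf.exists_lipschitz (hΩ : IsOpen Ω) {T : ℝ} (hT : 0 < T) {c : ℝ → H10 Ω}
    (hc : ContinuousOn (fun t => (c t).fn) (Icc 0 T)) (h : IsW1infW2inf Ω T c) :
    ∃ K : ℝ, 0 ≤ K ∧ ∀ t ∈ Icc 0 T, ∀ r ∈ Icc 0 T, ‖c t - c r‖ ≤ K * |t - r| := by
  obtain ⟨U, V, hU, hV, hWU, -, hd, hUc⟩ := h
  have hUi : Integrable U (timeMeasure T) := hU.integrable (by simp)
  have hVi : Integrable V (timeMeasure T) := hV.integrable (by simp)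
  have hd' := hd.clm_comp hUi hVi (jetToL2 Ω)
  obtain ⟨s, hs1, hs2, hs3⟩ := hd'.exists_integral_eq_sub
    ((jetToL2 Ω).integrable_comp hUi) ((jetToL2 Ω).integrable_comp hVi)
  obtain ⟨M, hM⟩ : ∃ M : ℝ, ∀ᵐ t ∂(timeMeasure T), ‖V t‖ ≤ M := by
    refine ⟨(eLpNormEssSup V (timeMeasure T)).toReal, ?_⟩
    filter_upwards [ae_le_eLpNormEssSup (f := V) (μ := timeMeasure T)] with t ht
    rw [← toReal_enorm]
    refine ENNReal.toReal_mono ?_ ht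
    rw [← eLpNorm_exponent_top]
    exact hV.2.ne
  let K : ℝ := ‖jetToL2 Ω‖ * |M|
  have hK0 : 0 ≤ K := by positivity
  have hK : ∀ᵐ t ∂volume, t ∈ Ioo 0 T → ‖jetToL2 Ω (V t)‖ ≤ K := by
    rw [← ae_restrict_iff' measurableSet_Ioo]
    filter_upwards [hM] with t ht
    exact (jetToL2 Ω).le_opNorm_of_le (ht.trans (le_abs_self M))
  let F : ℝ → L2 Ω × L2v Ω := fun t => H10.incl Ω (c t)
  -- The times at which the primitive formula holds and the solution agrees with its jet; almost
  -- every time qualifies.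
  let s' : Set ℝ := {t | t ∈ s ∧ F t = jetToL2 Ω (U t)}
  have hs' : ∀ᵐ t ∂(timeMeasure T), t ∈ s' := by
    filter_upwards [hs2, hWU, hUc] with t h1 h2 h3
    exact ⟨h1, H10.incl_eq_jetToL2 hΩ h2 h3⟩
  have hlip : ∀ a ∈ s', ∀ b ∈ s', ‖F b - F a‖ ≤ K * |b - a| := by
    rintro a ⟨ha, ha'⟩ b ⟨hb, hb'⟩
    rw [ha', hb', ← hs3 a ha b hb]
    refine intervalIntegral.norm_integral_le_of_norm_le_const_ae ?_
    filter_upwards [hK] with t ht hab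
    refine ht ?_
    have h1 := hs1 ha
    have h2 := hs1 hb
    rw [uIoc_eq_union] at hab
    rcases hab with hab | hab
    · exact ⟨h1.1.trans hab.1, hab.2.trans_lt h2.2⟩
    · exact ⟨h2.1.trans hab.1, hab.2.trans_lt h1.2⟩
  have hsub : s' ⊆ Icc 0 T := fun t ht => Ioo_subset_Icc_self (hs1 ht.1)
  -- At an arbitrary time the Lipschitz bound gives a limit along `s'`, which stays in the closed
  -- space H¹₀. Continuity in L² identifies its function with that of c(t), and an element of H¹₀ is
  -- determined by its function.
  have hlim : ∀ t ∈ Icc 0 T, Tendsto F (𝓝[s'] t) (𝓝 (F t)) := by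
    intro t ht
    have hne := nhdsWithin_neBot_of_ae_mem hT hs' ht
    have hL : LipschitzOnWith K.toNNReal F s' := by
      refine LipschitzOnWith.of_dist_le_mul fun a ha b hb => ?_
      rw [dist_eq_norm, Real.dist_eq, Real.coe_toNNReal _ hK0]
      exact hlip b hb a ha
    have hcau : Cauchy (map F (𝓝[s'] t)) :=
      (cauchy_nhds.mono' hne inf_le_left).map_of_le hL.uniformContinuousOn inf_le_right
    obtain ⟨y, hy⟩ := CompleteSpace.complete hcau
    have hymem : y ∈ H10Submodule Ω :=
      (Submodule.isClosed_topologicalClosure _).mem_of_tendsto hy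
        (Eventually.of_forall fun r => (c r).2)
    let w : H10 Ω := ⟨y, hymem⟩
    have hw : w = c t := by
      refine H10.ext_fn hΩ ?_
      have h1 : Tendsto (fun r => (c r).fn) (𝓝[s'] t) (𝓝 w.fn) :=
        (continuous_fst.tendsto y).comp hy
      exact tendsto_nhds_unique h1 ((hc t ht).mono hsub)
    have : F t = y := by rw [show F t = H10.incl Ω w by rw [hw]]; rfl
    rw [this]
    exact hy
  refine ⟨K, hK0, fun t ht r hr => ?_⟩
  have h1 := nhdsWithin_neBot_of_ae_mem hT hs' ht
  have h2 := nhdsWithin_neBot_of_ae_mem hT hs' hr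
  change ‖F t - F r‖ ≤ _
  have e1 : Tendsto (fun q : ℝ × ℝ => ‖F q.1 - F q.2‖) (𝓝[s'] t ×ˢ 𝓝[s'] r)
      (𝓝 ‖F t - F r‖) :=
    (((hlim t ht).comp tendsto_fst).sub ((hlim r hr).comp tendsto_snd)).norm
  have e2 : Tendsto (fun q : ℝ × ℝ => K * |q.1 - q.2|) (𝓝[s'] t ×ˢ 𝓝[s'] r)
      (𝓝 (K * |t - r|)) := by
    have i1 : Tendsto (fun x : ℝ => x) (𝓝[s'] t) (𝓝 t) := tendsto_id.mono_left inf_le_left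
    have i2 : Tendsto (fun x : ℝ => x) (𝓝[s'] r) (𝓝 r) := tendsto_id.mono_left inf_le_left
    exact (((i1.comp tendsto_fst).sub (i2.comp tendsto_snd)).abs).const_mul K
  refine le_of_tendsto_of_tendsto e1 e2 ?_
  filter_upwards [prod_mem_prod self_mem_nhdsWithin self_mem_nhdsWithin] with q hq
  exact hlip q.2 hq.2 q.1 hq.1

end Sobolev

end GDM

/-! ### The nonlinearity and the divergence of averaged gradients -/

namespace GDM

variable {d : ℕ}

/-- The operator `(u, p) ↦ A(g(u), p) - f(u)` from `L²(Ω) × L²(Ω)^d` to `L²(Ω)`, defined by its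
scalar products. -/
lemma exists_nemytskii {Ω : Set (E d)} [IsFiniteMeasure (volume.restrict Ω)] {l₁ l₂ l₃ : ℝ}
    (hl₁ : 0 ≤ l₁) (hl₂ : 0 ≤ l₂) (hl₃ : 0 ≤ l₃)
    {A : ℝ → E d → ℝ} (hA : ∀ r s : ℝ, ∀ p q : E d, |A r p - A s q| ≤ l₁ * (|r - s| + ‖p - q‖))
    {g : ℝ → ℝ} (hg : ∀ r s : ℝ, |g r - g s| ≤ l₂ * |r - s|)
    {f : ℝ → ℝ} (hf : ∀ r s : ℝ, |f r - f s| ≤ l₃ * |r - s|) :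
    ∃ F : L2 Ω → L2v Ω → L2 Ω,
      (∀ u p (h : L2 Ω), (∫ x in Ω, A (g (u x)) (p x) * h x) - ∫ x in Ω, f (u x) * h x
        = inner ℝ (F u p) h) ∧
      ∀ u v p q, ‖F u p - F v q‖ ≤ (l₁ * l₂ + l₃) * ‖u - v‖ + l₁ * ‖p - q‖ := by
  have hgc : Continuous g := (LipschitzWith.of_dist_le_mul (K := l₂.toNNReal) fun r s => by
    rw [Real.dist_eq, Real.dist_eq, Real.coe_toNNReal _ hl₂]; exact hg r s).continuous
  have hfc : Continuous f := (LipschitzWith.of_dist_le_mul (K := l₃.toNNReal) fun r s => by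
    rw [Real.dist_eq, Real.dist_eq, Real.coe_toNNReal _ hl₃]; exact hf r s).continuous
  have hAc : Continuous fun z : ℝ × E d => A z.1 z.2 :=
    -- The factor 2 appears because the distance on the product is a maximum, while the hypothesis
    -- has a sum.
    (LipschitzWith.of_dist_le_mul (K := (2 * l₁).toNNReal) fun z w => by
      rw [Real.dist_eq, Real.coe_toNNReal _ (by positivity)]
      refine (hA _ _ _ _).trans ?_
      have h1 : |z.1 - w.1| ≤ dist z w := le_max_left _ _
      have h2 : ‖z.2 - w.2‖ ≤ dist z w := by
        rw [← dist_eq_norm]; exact le_max_right _ _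
      nlinarith).continuous
  have hAg : ∀ r s p q, |A (g r) p - A (g s) q| ≤ l₁ * l₂ * |r - s| + l₁ * ‖p - q‖ := by
    intro r s p q
    refine (hA _ _ _ _).trans ?_
    have := mul_le_mul_of_nonneg_left (hg r s) hl₁
    linarith
  have mf : ∀ u : L2 Ω, MemLp (fun x => f (u x)) 2 (volume.restrict Ω) := by
    intro u
    refine (((Lp.memLp u).norm.const_mul l₃).add (memLp_const |f 0|)).mono'
      (hfc.comp_aestronglyMeasurable (Lp.aestronglyMeasurable u))
      (Eventually.of_forall fun x => ?_)
    have h1 := hf (u x) 0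
    have h2 := abs_sub_abs_le_abs_sub (f (u x)) (f 0)
    rw [sub_zero] at h1
    simp only [Pi.add_apply, Real.norm_eq_abs]
    linarith
  have mA : ∀ (u : L2 Ω) (p : L2v Ω),
      MemLp (fun x => A (g (u x)) (p x)) 2 (volume.restrict Ω) := by
    intro u p
    refine ((((Lp.memLp u).norm.const_mul (l₁ * l₂)).add ((Lp.memLp p).norm.const_mul l₁)).add
      (memLp_const |A (g 0) 0|)).mono'
      (hAc.comp_aestronglyMeasurable ((hgc.comp_aestronglyMeasurable
        (Lp.aestronglyMeasurable u)).prodMk (Lp.aestronglyMeasurable p)))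
      (Eventually.of_forall fun x => ?_)
    have h1 := hAg (u x) 0 (p x) 0
    have h2 := abs_sub_abs_le_abs_sub (A (g (u x)) (p x)) (A (g 0) 0)
    rw [sub_zero, sub_zero] at h1
    simp only [Pi.add_apply, Real.norm_eq_abs]
    linarith
  refine ⟨fun u p => (mA u p).toLp - (mf u).toLp, fun u p h => ?_, fun u v p q => ?_⟩
  · rw [inner_sub_left, L2.inner_def, L2.inner_def]
    congr 1
    · refine integral_congr_ae ?_
      filter_upwards [(mA u p).coeFn_toLp] with x hx
      simp [hx, mul_comm]
    · refine integral_congr_ae ?_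
      filter_upwards [(mf u).coeFn_toLp] with x hx
      simp [hx, mul_comm]
  · let a : L2 Ω := (Lp.memLp (u - v)).norm.toLp
    let b : L2 Ω := (Lp.memLp (p - q)).norm.toLp
    have ha : ‖a‖ = ‖u - v‖ := by rw [Lp.norm_toLp, eLpNorm_norm, Lp.norm_def]
    have hb : ‖b‖ = ‖p - q‖ := by rw [Lp.norm_toLp, eLpNorm_norm, Lp.norm_def]
    calc _ ≤ ‖(l₁ * l₂ + l₃) • a + l₁ • b‖ := by
          refine Lp.norm_le_norm_of_ae_le ?_
          filter_upwards [(Lp.memLp (u - v)).norm.coeFn_toLp, (Lp.memLp (p - q)).norm.coeFn_toLp,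
            Lp.coeFn_add ((l₁ * l₂ + l₃) • a) (l₁ • b), Lp.coeFn_smul (l₁ * l₂ + l₃) a,
            Lp.coeFn_smul l₁ b, Lp.coeFn_sub ((mA u p).toLp - (mf u).toLp)
              ((mA v q).toLp - (mf v).toLp), Lp.coeFn_sub (mA u p).toLp (mf u).toLp,
            Lp.coeFn_sub (mA v q).toLp (mf v).toLp, (mA u p).coeFn_toLp, (mA v q).coeFn_toLp,
            (mf u).coeFn_toLp, (mf v).coeFn_toLp, Lp.coeFn_sub u v, Lp.coeFn_sub p q]
            with x h1 h2 h3 h4 h5 h6 h7 h8 h9 h10 h11 h12 h13 h14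
          have ha' : a x = |u x - v x| := h1.trans (by rw [h13]; rfl)
          have hb' : b x = ‖p x - q x‖ := h2.trans (by rw [h14]; rfl)
          rw [h3, h6]
          simp only [Pi.add_apply, Pi.sub_apply, h4, h5, h7, h8, h9, h10, h11, h12,
            Pi.smul_apply, smul_eq_mul, ha', hb', Real.norm_eq_abs]
          refine le_trans ?_ (le_abs_self _)
          have e1 := hAg (u x) (v x) (p x) (q x)
          have e2 := hf (u x) (v x)
          have e3 := abs_sub (A (g (u x)) (p x) - A (g (v x)) (q x)) (f (u x) - f (v x))
          rw [show A (g (u x)) (p x) - f (u x) - (A (g (v x)) (q x) - f (v x)) =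
            A (g (u x)) (p x) - A (g (v x)) (q x) - (f (u x) - f (v x)) by ring]
          linarith
      _ ≤ _ := by
          refine (norm_add_le _ _).trans (le_of_eq ?_)
          rw [norm_smul, norm_smul, ha, hb, Real.norm_of_nonneg (by positivity),
            Real.norm_of_nonneg hl₁]

/-- The fundamental theorem of calculus for weak derivatives that are continuous. -/
lemma IsWeakTimeDeriv.integral_eq_sub_of_continuousOn {X : Type*} [NormedAddCommGroup X]
    [NormedSpace ℝ X] [CompleteSpace X] {T : ℝ} (hT : 0 < T) {u v : ℝ → X}
    (h : IsWeakTimeDeriv T u v) (hu : ContinuousOn u (Icc 0 T)) (hv : ContinuousOn v (Icc 0 T))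
    {a b : ℝ} (ha : a ∈ Icc 0 T) (hb : b ∈ Icc 0 T) : ∫ t in a..b, v t = u b - u a := by
  have hint : ∀ {z : ℝ → X}, ContinuousOn z (Icc 0 T) → Integrable z (timeMeasure T) :=
    fun hz => (hz.integrableOn_compact isCompact_Icc).mono_set Ioo_subset_Icc_self
  obtain ⟨s, hs1, hs2, hs3⟩ := h.exists_integral_eq_sub (hint hu) (hint hv)
  have hsub : s ⊆ Icc 0 T := hs1.trans Ioo_subset_Icc_self
  have hii : ∀ {x y : ℝ}, x ∈ Icc 0 T → y ∈ Icc 0 T → IntervalIntegrable v volume x y :=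
    fun hx hy => (hv.mono (uIcc_subset_Icc hx hy)).intervalIntegrable
  have h0 : (0 : ℝ) ∈ Icc 0 T := ⟨le_rfl, hT.le⟩
  -- `G` takes a single value on a dense set of times, and it is continuous, so it is constant on
  -- [0, T].
  let G : ℝ → X := fun t => u t - ∫ r in (0 : ℝ)..t, v r
  have hG : ContinuousOn G (Icc 0 T) := by
    refine hu.sub ?_
    rw [← uIcc_of_le hT.le]
    refine intervalIntegral.continuousOn_primitive_interval ?_
    rw [uIcc_of_le hT.le]
    exact hv.integrableOn_compact isCompact_Icc
  have hne0 := nhdsWithin_neBot_of_ae_mem hT hs2 h0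
  obtain ⟨p, hp⟩ : s.Nonempty := nonempty_of_mem (self_mem_nhdsWithin (a := (0 : ℝ)))
  have hconst : ∀ t ∈ Icc 0 T, G t = G p := by
    intro t ht
    have hne := nhdsWithin_neBot_of_ae_mem hT hs2 ht
    refine tendsto_nhds_unique ((hG t ht).mono hsub) (tendsto_const_nhds.congr' ?_)
    filter_upwards [self_mem_nhdsWithin] with r hr
    have h1 := hs3 p hp r hr
    have h2 := intervalIntegral.integral_add_adjacent_intervals (hii h0 (hsub hp))
      (hii (hsub hp) (hsub hr))
    simp only [G]
    rw [← h2, h1]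
    abel
  have h1 : G b = G a := (hconst b hb).trans (hconst a ha).symm
  have h2 := intervalIntegral.integral_add_adjacent_intervals (hii h0 ha) (hii ha hb)
  simp only [G] at h1
  rw [← h2] at h1
  rw [← sub_eq_zero] at h1 ⊢
  rw [← neg_eq_zero, ← h1]
  abel

section WeakDiv

variable {Ω : Set (E d)}

/-- Test functions belong to `H_0^1(Ω)`. -/
lemma IsTest.exists_h10 {ψ : E d → ℝ} (hψ : IsTest Ω ψ) :
    ∃ φ : H10 Ω, φ.fn =ᵐ[volume.restrict Ω] ψ ∧ φ.grad =ᵐ[volume.restrict Ω] gradient ψ :=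
  ⟨⟨(hψ.memLp.toLp, hψ.memLp_gradient.toLp), Submodule.le_topologicalClosure _
    (Submodule.subset_span ⟨ψ, hψ, hψ.memLp.coeFn_toLp, hψ.memLp_gradient.coeFn_toLp⟩)⟩,
    hψ.memLp.coeFn_toLp, hψ.memLp_gradient.coeFn_toLp⟩

lemma isWeakDiv_of_forall_h10 {ξ : L2v Ω} {δ : L2 Ω}
    (h : ∀ φ : H10 Ω, inner ℝ ξ φ.grad = -inner ℝ δ φ.fn) : IsWeakDiv ξ δ := by
  intro ψ hψ
  obtain ⟨φ, h1, h2⟩ := hψ.exists_h10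
  have := h φ
  rw [L2.inner_def, L2.inner_def] at this
  convert this using 1
  · refine integral_congr_ae ?_
    filter_upwards [h2] with x hx
    rw [hx]
  · congr 1
    refine integral_congr_ae ?_
    filter_upwards [h1] with x hx
    simp [hx, mul_comm]

/-- The divergence is defined by choice; by uniqueness, any divergence that has been computed is the
chosen one. -/
lemma weakDiv_eq [IsFiniteMeasure (volume.restrict Ω)] (hΩ : IsOpen Ω) {ξ : L2v Ω} {δ : L2 Ω}
    (h : IsWeakDiv ξ δ) : weakDiv ξ = δ := by
  have hex : ∃ δ : L2 Ω, IsWeakDiv ξ δ := ⟨δ, h⟩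
  have h1 : IsWeakDiv ξ (weakDiv ξ) := by
    rw [weakDiv, dif_pos hex]
    exact hex.choose_spec
  rw [← sub_eq_zero]
  ext1
  refine EventuallyEq.trans ?_ (Lp.coeFn_zero ℝ 2 _).symm
  refine ae_eq_zero_of_forall_isTest hΩ ((Lp.memLp _).integrable (by norm_num)) fun φ hφ => ?_
  have hi : ∀ z : L2 Ω, Integrable (fun x => z x * φ x) (volume.restrict Ω) := fun z =>
    (Lp.memLp z).integrable_mul hφ.memLp
  have e : ∫ x in Ω, φ x • (weakDiv ξ - δ : L2 Ω) x
      = ∫ x in Ω, (weakDiv ξ x * φ x - δ x * φ x) := by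
    refine integral_congr_ae ?_
    filter_upwards [Lp.coeFn_sub (weakDiv ξ) δ] with x hx
    rw [hx, Pi.sub_apply, smul_eq_mul]
    ring
  have h2 := h1 φ hφ
  rw [h φ hφ, neg_inj] at h2
  rw [e, integral_sub (hi _) (hi _), h2, sub_self]

end WeakDiv

lemma continuous_h10_fn {Ω : Set (E d)} : Continuous (H10.fn (Ω := Ω)) :=
  continuous_fst.comp (H10.incl Ω).continuous

lemma continuous_h10_grad {Ω : Set (E d)} : Continuous (H10.grad (Ω := Ω)) :=
  continuous_snd.comp (H10.incl Ω).continuous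

lemma continuous_toHneg {Ω : Set (E d)} : Continuous (H10.toHneg (Ω := Ω)) := by
  unfold H10.toHneg
  have : Continuous fun u : H10 Ω => innerSL ℝ u.fn :=
    (innerSL ℝ (E := L2 Ω)).continuous.comp continuous_h10_fn
  fun_prop

/-- The divergence of the mean value of `∇c` over a time interval, for a weak solution `c`. -/
lemma IsWeakSolution.isWeakDiv_average {Ω : Set (E d)} {T lam : ℝ} (hT : 0 < T) (hlam : 0 < lam)
    {A : ℝ → E d → ℝ} {g f : ℝ → ℝ} {c₀ : L2 Ω} {c : ℝ → H10 Ω}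
    (h : IsWeakSolution Ω T lam A g f c₀ c) (hc : ContinuousOn c (Icc 0 T))
    {F : L2 Ω → L2v Ω → L2 Ω}
    (hF : ∀ u p (h : L2 Ω), (∫ x in Ω, A (g (u x)) (p x) * h x) - ∫ x in Ω, f (u x) * h x
        = inner ℝ (F u p) h)
    (hFc : ContinuousOn (fun t => F (c t).fn (c t).grad) (Icc 0 T))
    {a b : ℝ} (ha : a ∈ Icc 0 T) (hb : b ∈ Icc 0 T) :
    IsWeakDiv ((b - a)⁻¹ • ∫ t in a..b, (c t).grad)
      (lam⁻¹ • (((b - a)⁻¹ • (c b - c a)).fn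
        + (b - a)⁻¹ • ∫ t in a..b, F (c t).fn (c t).grad)) := by
  obtain ⟨w, hw, hwd, heq⟩ := h.equation
  have hgc : ContinuousOn (fun t => (c t).grad) (Icc 0 T) := continuous_h10_grad.comp_continuousOn hc
  have hfc : ContinuousOn (fun t => (c t).fn) (Icc 0 T) := continuous_h10_fn.comp_continuousOn hc
  have hsub := uIcc_subset_Icc ha hb
  refine isWeakDiv_of_forall_h10 fun φ => ?_
  have hd := hwd.clm_comp (((continuous_toHneg.comp_continuousOn hc).integrableOn_compact
    isCompact_Icc).mono_set Ioo_subset_Icc_self) (hw.integrable (by norm_num))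
    (ContinuousLinearMap.apply ℝ ℝ φ)
  -- Paired with φ, the equation says that ⟨φ, c(t)⟩ has weak derivative `y`. Since `y` is
  -- continuous, it can be integrated between any two times, in particular the discrete ones.
  let y : ℝ → ℝ := fun t => -(lam * inner ℝ φ.grad (c t).grad + inner ℝ φ.fn (F (c t).fn (c t).grad))
  have hd' : IsWeakTimeDeriv T (fun t => inner ℝ φ.fn (c t).fn) y := by
    intro θ h1 h2 h3
    have := hd θ h1 h2 h3
    refine Eq.trans ?_ (this.trans (congrArg Neg.neg ?_))
    · refine integral_congr_ae (Eventually.of_forall fun t => ?_)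
      have : (c t).toHneg φ = inner ℝ φ.fn (c t).fn := real_inner_comm φ.fn (c t).fn
      exact congrArg (deriv θ t • ·) this.symm
    · refine integral_congr_ae ?_
      filter_upwards [heq] with t ht
      have e1 := ht φ
      have e2 := hF (c t).fn (c t).grad φ.fn
      simp only [y, ContinuousLinearMap.apply_apply]
      rw [real_inner_comm, real_inner_comm (F _ _)]
      congr 1
      linarith
  have hyc : ContinuousOn y (Icc 0 T) := by
    refine ((continuousOn_const.mul ?_).add ?_).neg
    · exact continuousOn_const.inner hgc
    · exact continuousOn_const.inner hFc
  have key := hd'.integral_eq_sub_of_continuousOn hT (continuousOn_const.inner hfc) hyc ha hb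
  have i1 : IntervalIntegrable (fun t => (c t).grad) volume a b :=
    (hgc.mono hsub).intervalIntegrable
  have i2 : IntervalIntegrable (fun t => F (c t).fn (c t).grad) volume a b :=
    (hFc.mono hsub).intervalIntegrable
  have e1 : ∫ t in a..b, inner ℝ φ.grad (c t).grad = inner ℝ φ.grad (∫ t in a..b, (c t).grad) :=
    (innerSL ℝ φ.grad).intervalIntegral_comp_comm i1
  have e2 : ∫ t in a..b, inner ℝ φ.fn (F (c t).fn (c t).grad)
      = inner ℝ φ.fn (∫ t in a..b, F (c t).fn (c t).grad) :=
    (innerSL ℝ φ.fn).intervalIntegral_comp_comm i2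
  have i3 : IntervalIntegrable (fun t => inner ℝ φ.grad (c t).grad) volume a b :=
    (continuousOn_const.inner (hgc.mono hsub)).intervalIntegrable
  have i4 : IntervalIntegrable (fun t => inner ℝ φ.fn (F (c t).fn (c t).grad)) volume a b :=
    (continuousOn_const.inner (hFc.mono hsub)).intervalIntegrable
  simp only [y] at key
  rw [intervalIntegral.integral_neg, intervalIntegral.integral_add (i3.const_mul lam) i4,
    intervalIntegral.integral_const_mul, e1, e2, ← inner_sub_right] at key
  have e3 : ((b - a)⁻¹ • (c b - c a)).fn = (b - a)⁻¹ • ((c b).fn - (c a).fn) := by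
    simp [H10.fn, map_smul, map_sub]
  rw [e3, ← smul_add, smul_comm, real_inner_smul_left, real_inner_smul_left, real_inner_smul_left,
    inner_add_left, real_inner_comm, real_inner_comm φ.fn, real_inner_comm φ.fn, ← key]
  field_simp
  ring

end GDM

/-! ### Discrete Gronwall inequality and energy estimate -/

namespace GDM

variable {d : ℕ}

/-- An implicit discrete Gronwall inequality with a dissipation term. -/
lemma implicit_gronwall {N : ℕ} {a b ρ τ : ℕ → ℝ} {K lam : ℝ} (hK : 0 ≤ K) (hlam : 0 ≤ lam)
    (ha : ∀ m, 0 ≤ a m) (hb : ∀ m, 0 ≤ b m) (hρ : ∀ m, 0 ≤ ρ m)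
    (hτ : ∀ m < N, 0 ≤ τ m) (hτK : ∀ m < N, 2 * K * τ m ≤ 1 / 2)
    (h : ∀ m < N, a (m + 1) - a m + lam * τ m * b (m + 1) ≤ 2 * K * τ m * a (m + 1) + τ m * ρ m) :
    ∀ m ≤ N, a m + lam * ∑ j ∈ Finset.range m, τ j * b (j + 1) ≤
      Real.exp (4 * K * ∑ j ∈ Finset.range m, τ j) *
        (a 0 + ∑ j ∈ Finset.range m, τ j * ρ j) := by
  intro m
  induction m with
  | zero => simp
  | succ m ih =>
    intro hm
    have ih := ih (by omega)
    have hmN : m < N := hm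
    have h1 := h m hmN
    have ht := hτ m hmN
    have hx := hτK m hmN
    set x := 2 * K * τ m with hxdef
    have hx0 : 0 ≤ x := by positivity
    have hE : 1 + 2 * x ≤ Real.exp (2 * x) := by linarith [Real.add_one_le_exp (2 * x)]
    -- Since 0 ≤ x ≤ 1/2, (1 + 2x)(1 - x) = 1 + x(1 - 2x) ≥ 1. This absorbs the implicit term and is
    -- where the restriction on the time step is used.
    have hE1 : 1 ≤ Real.exp (2 * x) * (1 - x) := by
      have := mul_le_mul_of_nonneg_right hE (by linarith : 0 ≤ 1 - x)
      nlinarith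
    have hE2 : 1 ≤ Real.exp (2 * x) := by linarith
    set B := lam * ∑ j ∈ Finset.range m, τ j * b (j + 1) with hB
    set S := ∑ j ∈ Finset.range m, τ j * ρ j with hS
    set R := ∑ j ∈ Finset.range m, τ j with hR
    have hB0 : 0 ≤ B := mul_nonneg hlam (Finset.sum_nonneg fun j hj =>
      mul_nonneg (hτ j (by have := Finset.mem_range.1 hj; omega)) (hb _))
    have hR0 : 0 ≤ R := Finset.sum_nonneg fun j hj =>
      hτ j (by have := Finset.mem_range.1 hj; omega)
    have hl : 0 ≤ lam * τ m * b (m + 1) := mul_nonneg (mul_nonneg hlam ht) (hb _)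
    have hr : 0 ≤ τ m * ρ m := mul_nonneg ht (hρ m)
    rw [Finset.sum_range_succ, Finset.sum_range_succ, Finset.sum_range_succ, ← hS, ← hR]
    have hexp : Real.exp (4 * K * (R + τ m)) = Real.exp (2 * x) * Real.exp (4 * K * R) := by
      rw [← Real.exp_add]; congr 1; rw [hxdef]; ring
    have hE4 : 1 ≤ Real.exp (4 * K * R) := Real.one_le_exp (by positivity)
    have h2 : a (m + 1) * (1 - x) + lam * τ m * b (m + 1) + B ≤ a m + B + τ m * ρ m := by linarith
    have h3 : Real.exp (2 * x) * (a (m + 1) * (1 - x) + lam * τ m * b (m + 1) + B) ≤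
        Real.exp (2 * x) * (Real.exp (4 * K * R) * (a 0 + S + τ m * ρ m)) := by
      refine mul_le_mul_of_nonneg_left ?_ (Real.exp_pos _).le
      nlinarith
    rw [hexp, mul_add lam, ← hB]
    nlinarith [mul_le_mul_of_nonneg_right hE1 (ha (m + 1)), mul_le_mul_of_nonneg_right hE2 hl,
      mul_le_mul_of_nonneg_right hE2 hB0]

/-- The energy estimate for one step of an implicit scheme. -/
lemma implicit_energy_step {H G : Type*} [NormedAddCommGroup H] [InnerProductSpace ℝ H]
    [NormedAddCommGroup G] {τ lam R r K₁ l₁ : ℝ} (hτ : 0 < τ) (hlam : 0 < lam) {e' e : H} {G₁ : G}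
    (h : inner ℝ (τ⁻¹ • (e - e')) e + lam * ‖G₁‖ ^ 2 = R)
    (hR : R ≤ r * (‖e‖ + ‖G₁‖) + K₁ * ‖e‖ ^ 2 + l₁ * ‖e‖ * ‖G₁‖) :
    ‖e‖ ^ 2 - ‖e'‖ ^ 2 + lam * τ * ‖G₁‖ ^ 2 ≤
      2 * (K₁ + l₁ ^ 2 / lam + 1 / 2) * τ * ‖e‖ ^ 2 + τ * (2 * (1 / lam + 1 / 2) * r ^ 2) := by
  have h1 : ‖e‖ ^ 2 - ‖e'‖ ^ 2 ≤ 2 * inner ℝ (e - e') e := by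
    rw [inner_sub_left, real_inner_self_eq_norm_sq]
    have := real_inner_le_norm e' e
    nlinarith [sq_nonneg (‖e'‖ - ‖e‖)]
  rw [real_inner_smul_left] at h
  have h2 : inner ℝ (e - e') e = τ * (R - lam * ‖G₁‖ ^ 2) := by
    rw [← h]; field_simp; ring
  -- Young's inequality is used twice with weight λ/4. Half of the diffusion survives, and the
  -- factor 2 in `h1` restores the coefficient λ.
  have y1 : r * ‖G₁‖ ≤ lam / 4 * ‖G₁‖ ^ 2 + r ^ 2 / lam := by
    have : lam / 4 * ‖G₁‖ ^ 2 + r ^ 2 / lam - r * ‖G₁‖ = (lam * ‖G₁‖ - 2 * r) ^ 2 / (4 * lam) := by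
      field_simp; ring
    have h0 : 0 ≤ (lam * ‖G₁‖ - 2 * r) ^ 2 / (4 * lam) := by positivity
    linarith
  have y2 : l₁ * ‖e‖ * ‖G₁‖ ≤ lam / 4 * ‖G₁‖ ^ 2 + l₁ ^ 2 / lam * ‖e‖ ^ 2 := by
    have : lam / 4 * ‖G₁‖ ^ 2 + l₁ ^ 2 / lam * ‖e‖ ^ 2 - l₁ * ‖e‖ * ‖G₁‖
        = (lam * ‖G₁‖ - 2 * (l₁ * ‖e‖)) ^ 2 / (4 * lam) := by
      field_simp; ring
    have h0 : 0 ≤ (lam * ‖G₁‖ - 2 * (l₁ * ‖e‖)) ^ 2 / (4 * lam) := by positivity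
    linarith
  have y3 : r * ‖e‖ ≤ r ^ 2 / 2 + ‖e‖ ^ 2 / 2 := by nlinarith [sq_nonneg (r - ‖e‖)]
  have h3 : R - lam * ‖G₁‖ ^ 2 ≤ (K₁ + l₁ ^ 2 / lam + 1 / 2) * ‖e‖ ^ 2
      + (1 / lam + 1 / 2) * r ^ 2 - lam / 2 * ‖G₁‖ ^ 2 := by
    have : (1 / lam + 1 / 2) * r ^ 2 = r ^ 2 / lam + r ^ 2 / 2 := by ring
    rw [this]
    nlinarith
  have h4 := mul_le_mul_of_nonneg_left h3 hτ.le
  nlinarith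

/-- The mean value of a function over `[a, b]` is close to its value at `b`. -/
lemma norm_average_sub_le {X : Type*} [NormedAddCommGroup X] [NormedSpace ℝ X] [CompleteSpace X]
    {a b κ : ℝ} (hab : a < b) {z : ℝ → X} (hz : ContinuousOn z (Icc a b))
    (h : ∀ t ∈ Icc a b, ‖z t - z b‖ ≤ κ) : ‖(b - a)⁻¹ • (∫ t in a..b, z t) - z b‖ ≤ κ := by
  have hba : 0 < b - a := sub_pos.2 hab
  have e : (b - a)⁻¹ • (∫ t in a..b, z t) - z b = (b - a)⁻¹ • ∫ t in a..b, (z t - z b) := by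
    rw [intervalIntegral.integral_sub ((hz.mono (by rw [uIcc_of_le hab.le])).intervalIntegrable)
      intervalIntegrable_const, intervalIntegral.integral_const, smul_sub, smul_smul,
      inv_mul_cancel₀ hba.ne', one_smul]
  rw [e, norm_smul, norm_inv, Real.norm_of_nonneg hba.le, inv_mul_le_iff₀ hba]
  refine (intervalIntegral.norm_integral_le_of_norm_le_const (C := κ) fun t ht => ?_).trans
    (le_of_eq ?_)
  · rw [uIoc_of_le hab.le] at ht
    exact h t ⟨ht.1.le, ht.2⟩
  · rw [abs_of_pos hba, mul_comm]

section H10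

variable {Ω : Set (E d)}

lemma H10.norm_fn_le (u : H10 Ω) : ‖u.fn‖ ≤ ‖u‖ := le_max_left _ _

lemma H10.norm_grad_le (u : H10 Ω) : ‖u.grad‖ ≤ ‖u‖ := le_max_right _ _

lemma H10.fn_sub (u v : H10 Ω) : (u - v).fn = u.fn - v.fn := rfl

lemma H10.grad_sub (u v : H10 Ω) : (u - v).grad = u.grad - v.grad := rfl

end H10

/-! ### Basic properties of gradient discretisations -/

namespace GradDisc

variable {Ω : Set (E d)} {T : ℝ} (D : GradDisc Ω T)

lemma grad_norm_pos {u : D.X} (hu : u ≠ 0) : 0 < ‖D.grad u‖ :=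
  (norm_nonneg _).lt_of_ne' fun h => hu (D.grad_eq_zero u h)

/-- The gradient reconstruction is injective and the space is finite dimensional. The bound makes
the set defining W_D bounded above, without which its `sSup` would bound nothing. -/
lemma exists_norm_recon_le : ∃ C : ℝ, ∀ u : D.X, ‖D.recon u‖ ≤ C * ‖D.grad u‖ := by
  have hinj : Function.Injective D.grad := by
    rw [injective_iff_map_eq_zero]
    intro u hu
    exact D.grad_eq_zero u (by rw [hu, norm_zero])
  let e := LinearEquiv.ofInjective D.grad hinj
  let L := LinearMap.toContinuousLinearMap (D.recon ∘ₗ e.symm.toLinearMap)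
  refine ⟨‖L‖, fun u => ?_⟩
  have h1 : L (e u) = D.recon u := by simp [L]
  have h2 : ‖e u‖ = ‖D.grad u‖ := rfl
  rw [← h1, ← h2]
  exact L.le_opNorm _

lemma CD_nonneg : 0 ≤ D.CD := Real.sSup_nonneg fun r ⟨u, _, hr⟩ => by rw [hr]; positivity

lemma SD_nonneg (w : H10 Ω) : 0 ≤ D.SD w := Real.iInf_nonneg fun u => by positivity

lemma WD_nonneg (ξ : L2v Ω) : 0 ≤ D.WD ξ :=
  Real.sSup_nonneg fun r ⟨u, _, hr⟩ => by rw [hr]; positivity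

/-- A near-minimiser suffices, so attainment of the infimum is not needed; the slack is later taken
to be δt, which the error bound already contains. -/
lemma exists_le_SD_add (w : H10 Ω) {η : ℝ} (hη : 0 < η) :
    ∃ u : D.X, ‖D.recon u - w.fn‖ + ‖D.grad u - w.grad‖ ≤ D.SD w + η := by
  obtain ⟨u, hu⟩ := exists_lt_of_ciInf_lt (lt_add_of_pos_right (D.SD w) hη)
  exact ⟨u, hu.le⟩

lemma abs_le_WD_mul (ξ : L2v Ω) (u : D.X) :
    |inner ℝ (D.grad u) ξ + inner ℝ (D.recon u) (weakDiv ξ)| ≤ D.WD ξ * ‖D.grad u‖ := by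
  by_cases hu : u = 0
  · simp [hu]
  have hpos := D.grad_norm_pos hu
  rw [← div_le_iff₀ hpos]
  obtain ⟨C, hC⟩ := D.exists_norm_recon_le
  refine le_csSup ⟨‖ξ‖ + C * ‖weakDiv ξ‖, ?_⟩ ⟨u, hu, rfl⟩
  rintro r ⟨v, hv, rfl⟩
  rw [div_le_iff₀ (D.grad_norm_pos hv)]
  have h1 := abs_real_inner_le_norm (D.grad v) ξ
  have h2 := abs_real_inner_le_norm (D.recon v) (weakDiv ξ)
  have h3 := mul_le_mul_of_nonneg_right (hC v) (norm_nonneg (weakDiv ξ))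
  refine (abs_add_le _ _).trans ?_
  linarith

lemma time_le {i j : ℕ} (hij : i ≤ j) (hj : j ≤ D.N) : D.time i ≤ D.time j := by
  induction j, hij using Nat.le_induction with
  | base => exact le_rfl
  | succ j hij ih => exact (ih (by omega)).trans (D.time_lt j (by omega)).le

lemma time_mem {m : ℕ} (hm : m ≤ D.N) : D.time m ∈ Icc 0 T := by
  constructor
  · rw [← D.time_zero]; exact D.time_le (Nat.zero_le _) hm
  · exact (D.time_le hm le_rfl).trans_eq D.time_last

lemma dt_pos {m : ℕ} (hm : m < D.N) : 0 < D.dt m := sub_pos.2 (D.time_lt m hm)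

lemma dt_le_dtMax {m : ℕ} (hm : m < D.N) : D.dt m ≤ D.dtMax :=
  le_ciSup (f := fun k : Fin D.N => D.dt k) (finite_range _).bddAbove ⟨m, hm⟩

lemma N_pos (hT : 0 < T) : 0 < D.N := by
  rcases Nat.eq_zero_or_pos D.N with h | h
  · have h1 := D.time_last
    rw [h, D.time_zero] at h1
    exact absurd h1 hT.ne
  · exact h

lemma dtMax_pos (hT : 0 < T) : 0 < D.dtMax :=
  (D.dt_pos (D.N_pos hT)).trans_le (D.dt_le_dtMax (D.N_pos hT))

lemma sum_dt (m : ℕ) : ∑ j ∈ Finset.range m, D.dt j = D.time m := by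
  rw [show (fun j => D.dt j) = fun j => D.time (j + 1) - D.time j from rfl,
    Finset.sum_range_sub, D.time_zero, sub_zero]

lemma exists_mem_Ioc {t : ℝ} (ht : t ∈ Ioo 0 T) :
    ∃ m < D.N, t ∈ Ioc (D.time m) (D.time (m + 1)) := by
  classical
  have hex : ∃ k, t ≤ D.time k := ⟨D.N, by rw [D.time_last]; exact ht.2.le⟩
  have hle : Nat.find hex ≤ D.N := Nat.find_min' hex (by rw [D.time_last]; exact ht.2.le)
  have hs := Nat.find_spec hex
  obtain ⟨m, hm⟩ : ∃ m, Nat.find hex = m + 1 := by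
    refine Nat.exists_eq_succ_of_ne_zero fun h0 => ?_
    rw [h0, D.time_zero] at hs
    linarith [ht.1]
  refine ⟨m, by omega, ?_, by rw [← hm]; exact hs⟩
  exact not_le.1 (Nat.find_min hex (m := m) (by omega))

lemma stepFn_eq {Y : Type*} [AddCommGroup Y] (v : ℕ → Y) {m : ℕ} (hm : m < D.N) {t : ℝ}
    (ht : t ∈ Ioc (D.time m) (D.time (m + 1))) : D.stepFn v t = v (m + 1) := by
  unfold stepFn
  rw [Finset.sum_eq_single m]
  · exact indicator_of_mem ht _
  · intro j hj hjm
    refine indicator_of_notMem (fun hc => ?_) _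
    have hj := Finset.mem_range.1 hj
    rcases lt_or_gt_of_ne hjm with h | h
    · have := D.time_le (i := j + 1) (j := m) (by omega) (by omega)
      linarith [hc.2, ht.1]
    · have := D.time_le (i := m + 1) (j := j) (by omega) (by omega)
      linarith [hc.1, ht.2]
  · exact fun h => absurd (Finset.mem_range.2 hm) h

/-- The `L²(0,T)` norm of a function that is bounded on each time step. -/
lemma eLpNorm_two_le {Y : Type*} [NormedAddCommGroup Y] {h : ℝ → Y} {β : ℕ → ℝ} {R : ℝ}
    (hR : 0 ≤ R) (hb : ∀ m < D.N, ∀ t ∈ Ioo 0 T, t ∈ Ioc (D.time m) (D.time (m + 1)) → ‖h t‖ ≤ β m)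
    (hβ : ∑ m ∈ Finset.range D.N, D.dt m * β m ^ 2 ≤ R ^ 2) :
    eLpNorm h 2 (timeMeasure T) ≤ ENNReal.ofReal R := by
  rw [eLpNorm_eq_lintegral_rpow_enorm_toReal (by norm_num) (by norm_num)]
  have key : ∫⁻ t in Ioo 0 T, ‖h t‖ₑ ^ (2 : ℝ≥0∞).toReal ≤ ENNReal.ofReal (R ^ 2) := by
    -- Comparing with a step function means that `h` need not be measurable.
    calc _ ≤ ∫⁻ t, ∑ m ∈ Finset.range D.N, (Ioc (D.time m) (D.time (m + 1))).indicator
            (fun _ => ENNReal.ofReal (β m ^ 2)) t := by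
          refine (lintegral_mono_ae ?_).trans (setLIntegral_le_lintegral (Ioo 0 T) _)
          filter_upwards [ae_restrict_mem measurableSet_Ioo] with t ht
          obtain ⟨m, hm, htm⟩ := D.exists_mem_Ioc ht
          refine le_trans ?_ (Finset.single_le_sum (f := fun m =>
            (Ioc (D.time m) (D.time (m + 1))).indicator (fun _ => ENNReal.ofReal (β m ^ 2)) t)
            (fun _ _ => zero_le) (Finset.mem_range.2 hm))
          rw [indicator_of_mem htm, ← ofReal_norm,
            ENNReal.ofReal_rpow_of_nonneg (norm_nonneg _) (by norm_num)]
          refine ENNReal.ofReal_le_ofReal ?_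
          simp only [ENNReal.toReal_ofNat, Real.rpow_ofNat]
          exact pow_le_pow_left₀ (norm_nonneg _) (hb m hm t ht htm) 2
      _ = ∑ m ∈ Finset.range D.N, ENNReal.ofReal (D.dt m * β m ^ 2) := by
          rw [lintegral_finsetSum _ fun m _ => measurable_const.indicator measurableSet_Ioc]
          refine Finset.sum_congr rfl fun m hm => ?_
          rw [lintegral_indicator_const measurableSet_Ioc, Real.volume_Ioc, mul_comm (D.dt m),
            ENNReal.ofReal_mul (sq_nonneg _)]
          rfl
      _ ≤ _ := by
          rw [← ENNReal.ofReal_sum_of_nonneg fun m hm =>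
            mul_nonneg (D.dt_pos (Finset.mem_range.1 hm)).le (sq_nonneg _)]
          exact ENNReal.ofReal_le_ofReal hβ
  calc _ ≤ ENNReal.ofReal (R ^ 2) ^ (1 / (2 : ℝ≥0∞).toReal) := by gcongr
    _ = ENNReal.ofReal R := by
        rw [ENNReal.ofReal_rpow_of_nonneg (sq_nonneg _) (by norm_num)]
        congr 1
        simp only [ENNReal.toReal_ofNat]
        rw [← Real.sqrt_eq_rpow, Real.sqrt_sq hR]

end GradDisc

end GDM

/-! ### Interpolants and the residual of one time step -/

namespace GDM

namespace GradDisc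

variable {d : ℕ} {Ω : Set (E d)} {T : ℝ} (D : GradDisc Ω T)

/-- The consistency error of one time step. -/
noncomputable def stepError (c : ℝ → H10 Ω) (m : ℕ) : ℝ :=
  D.dtMax + D.SD (c (D.time (m + 1))) + D.SD (D.diffQuot c m) + D.WD (D.avgGrad c m)

lemma stepError_nonneg (hT : 0 < T) (c : ℝ → H10 Ω) (m : ℕ) : 0 ≤ D.stepError c m := by
  have h1 := D.dtMax_pos hT
  have h2 := D.SD_nonneg (c (D.time (m + 1)))
  have h3 := D.SD_nonneg (D.diffQuot c m)
  have h4 := D.WD_nonneg (D.avgGrad c m)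
  unfold stepError
  positivity

lemma sum_stepError_sq (c : ℝ → H10 Ω) :
    ∑ m ∈ Finset.range D.N, D.dt m * D.stepError c m ^ 2 = D.MD c ^ 2 :=
  (Real.sq_sqrt (Finset.sum_nonneg fun _ hm =>
    mul_nonneg (D.dt_pos (Finset.mem_range.1 hm)).le (sq_nonneg _))).symm

lemma MD_nonneg (c : ℝ → H10 Ω) : 0 ≤ D.MD c := Real.sqrt_nonneg _

/-- Cauchy–Schwarz with the time steps as weights, of total mass T. -/
lemma sum_stepError_le (hT : 0 < T) (c : ℝ → H10 Ω) {m : ℕ} (hm : m ≤ D.N) :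
    ∑ j ∈ Finset.range m, D.dt j * D.stepError c j ≤ √T * D.MD c := by
  have hdt : ∀ j ∈ Finset.range D.N, 0 ≤ D.dt j := fun j hj => (D.dt_pos (Finset.mem_range.1 hj)).le
  calc _ ≤ ∑ j ∈ Finset.range D.N, D.dt j * D.stepError c j :=
        Finset.sum_le_sum_of_subset_of_nonneg (Finset.range_mono hm) fun j hj _ =>
          mul_nonneg (hdt j hj) (D.stepError_nonneg hT c j)
    _ ≤ √T * D.MD c := by
        refine abs_le_of_sq_le_sq' ?_ (mul_nonneg (Real.sqrt_nonneg _) (D.MD_nonneg c)) |>.2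
        rw [mul_pow, Real.sq_sqrt hT.le, ← D.sum_stepError_sq]
        have hs : ∑ j ∈ Finset.range D.N, D.dt j = T := (D.sum_dt D.N).trans D.time_last
        refine (Finset.sum_sq_le_sum_mul_sum_of_sq_le_mul (Finset.range D.N) hdt
          (fun j hj => mul_nonneg (hdt j hj) (sq_nonneg (D.stepError c j)))
          fun j _ => le_of_eq ?_).trans (le_of_eq (by rw [hs]))
        ring

/-- Discrete interpolants of a function of time and of its difference quotients. -/
lemma exists_interpolants (hT : 0 < T) (c : ℝ → H10 Ω) :
    ∃ P Q : ℕ → D.X, (∀ m, P (m + 1) = P m + D.dt m • Q m) ∧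
      (∀ m, ‖D.recon (Q m) - (D.diffQuot c m).fn‖ ≤ D.stepError c m) ∧
      (‖D.recon (P 0) - (c 0).fn‖ ≤ D.SD (c 0) + D.dtMax) ∧
      ∀ m ≤ D.N, ‖D.recon (P m) - (c (D.time m)).fn‖ ≤ D.SD (c 0) + D.dtMax + √T * D.MD c ∧
        ‖D.grad (P m) - (c (D.time m)).grad‖ ≤ D.SD (c 0) + D.dtMax + √T * D.MD c := by
  have hδ := D.dtMax_pos hT
  obtain ⟨p, hp⟩ := D.exists_le_SD_add (c 0) hδ
  choose Q hQ using fun m => D.exists_le_SD_add (D.diffQuot c m) hδ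
  have hQ' : ∀ m, ‖D.recon (Q m) - (D.diffQuot c m).fn‖ + ‖D.grad (Q m) - (D.diffQuot c m).grad‖
      ≤ D.stepError c m := fun m => (hQ m).trans (by
    have h2 := D.SD_nonneg (c (D.time (m + 1)))
    have h4 := D.WD_nonneg (D.avgGrad c m)
    unfold stepError
    linarith)
  -- Interpolating each c(t_m) separately would leave an interpolation error divided by δt in the
  -- difference quotients. Summation makes these quotients equal to `Q m`, and the errors accumulate
  -- only with weights δt.
  let P : ℕ → D.X := fun m => p + ∑ j ∈ Finset.range m, D.dt j • Q j
  have hP : ∀ m, P (m + 1) = P m + D.dt m • Q m := fun m => by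
    simp only [P, Finset.sum_range_succ, add_assoc]
  have hP0 : P 0 = p := by simp [P]
  have key : ∀ m ≤ D.N,
      ‖D.recon (P m) - (c (D.time m)).fn‖ + ‖D.grad (P m) - (c (D.time m)).grad‖ ≤
        D.SD (c 0) + D.dtMax + ∑ j ∈ Finset.range m, D.dt j * D.stepError c j := by
    intro m
    induction m with
    | zero =>
      intro _
      rw [hP0, D.time_zero, Finset.range_zero, Finset.sum_empty, add_zero]
      exact hp
    | succ m ih =>
      intro hm
      have ih := ih (by omega)
      have hdt := D.dt_pos hm
      have hc : c (D.time (m + 1)) = c (D.time m) + D.dt m • D.diffQuot c m := by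
        rw [diffQuot, smul_smul, mul_inv_cancel₀ hdt.ne', one_smul, add_sub_cancel]
      have e1 : D.recon (P (m + 1)) - (c (D.time (m + 1))).fn =
          (D.recon (P m) - (c (D.time m)).fn) +
            D.dt m • (D.recon (Q m) - (D.diffQuot c m).fn) := by
        have : (c (D.time (m + 1))).fn = (c (D.time m)).fn + D.dt m • (D.diffQuot c m).fn := by
          rw [hc]; rfl
        rw [this, hP, map_add, map_smul, smul_sub]
        abel
      have e2 : D.grad (P (m + 1)) - (c (D.time (m + 1))).grad =
          (D.grad (P m) - (c (D.time m)).grad) +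
            D.dt m • (D.grad (Q m) - (D.diffQuot c m).grad) := by
        have : (c (D.time (m + 1))).grad = (c (D.time m)).grad + D.dt m • (D.diffQuot c m).grad := by
          rw [hc]; rfl
        rw [this, hP, map_add, map_smul, smul_sub]
        abel
      have n1 := norm_add_le (D.recon (P m) - (c (D.time m)).fn)
        (D.dt m • (D.recon (Q m) - (D.diffQuot c m).fn))
      have n2 := norm_add_le (D.grad (P m) - (c (D.time m)).grad)
        (D.dt m • (D.grad (Q m) - (D.diffQuot c m).grad))
      rw [norm_smul, Real.norm_of_nonneg hdt.le] at n1 n2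
      have n3 := mul_le_mul_of_nonneg_left (hQ' m) hdt.le
      rw [e1, e2, Finset.sum_range_succ]
      linarith
  refine ⟨P, Q, hP, fun m => ?_, ?_, fun m hm => ?_⟩
  · have := norm_nonneg (D.grad (Q m) - (D.diffQuot c m).grad)
    linarith [hQ' m]
  · have := norm_nonneg (D.grad p - (c 0).grad)
    rw [hP0]
    linarith
  · have h1 := key m hm
    have h2 := D.sum_stepError_le hT c hm
    have h3 := norm_nonneg (D.recon (P m) - (c (D.time m)).fn)
    have h4 := norm_nonneg (D.grad (P m) - (c (D.time m)).grad)
    exact ⟨by linarith, by linarith⟩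

/-- Here a and b are the norms of the error and of its gradient, μ is the consistency error of the
step, and σ bounds the interpolation error. Only the Lipschitz nonlinearity contributes quadratic
terms; all else is linear in a + b. -/
lemma residual_arith {lam K₁ l₁ L σ δ μ a b i₁ i₂ i₃ i₄ : ℝ} (hlam : 0 ≤ lam) (hK₁ : 0 ≤ K₁)
    (hl₁ : 0 ≤ l₁) (hL : 0 ≤ L) (hδ : 0 ≤ δ) (hσ : δ ≤ σ) (hμ : 0 ≤ μ) (ha : 0 ≤ a) (hb : 0 ≤ b)
    (h₁ : i₁ ≤ μ * a) (h₂ : i₂ ≤ (σ + L * δ) * b)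
    (h₃ : i₃ ≤ (K₁ * (a + σ) + l₁ * (b + σ) + (K₁ + l₁) * (L * δ)) * a) (h₄ : i₄ ≤ μ * b) :
    i₁ + lam * i₂ + i₃ + lam * i₄ ≤ ((1 + lam) * μ + (lam + K₁ + l₁) * (1 + L) * σ) * (a + b)
      + K₁ * a ^ 2 + l₁ * a * b := by
  have b5 := mul_le_mul_of_nonneg_left h₂ hlam
  have b6 := mul_le_mul_of_nonneg_left h₄ hlam
  have hσ0 : 0 ≤ σ := hδ.trans hσ
  have hsl : σ + L * δ ≤ (1 + L) * σ := by
    have := mul_le_mul_of_nonneg_left hσ hL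
    linarith
  have c1 : lam * ((σ + L * δ) * b) ≤ lam * ((1 + L) * σ * b) := by gcongr
  have c2 : (K₁ + l₁) * (σ + L * δ) * a ≤ (K₁ + l₁) * ((1 + L) * σ) * a := by gcongr
  have c3 : 0 ≤ (K₁ + l₁) * ((1 + L) * σ) * b := by positivity
  have c4 : 0 ≤ lam * ((1 + L) * σ) * a := by positivity
  have c5 : 0 ≤ lam * μ * a := by positivity
  have c6 : 0 ≤ μ * b := by positivity
  linarith

lemma continuousOn_of_norm_sub_le {L : ℝ} (hL : 0 ≤ L) {cbar : ℝ → H10 Ω}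
    (hlip : ∀ t ∈ Icc 0 T, ∀ r ∈ Icc 0 T, ‖cbar t - cbar r‖ ≤ L * |t - r|) :
    ContinuousOn cbar (Icc 0 T) := by
  refine (LipschitzOnWith.of_dist_le_mul (K := L.toNNReal) fun t ht r hr => ?_).continuousOn
  rw [dist_eq_norm, Real.dist_eq, Real.coe_toNNReal _ hL]
  exact hlip t ht r hr

lemma norm_comp_sub_le {K₁ l₁ : ℝ} (hK₁ : 0 ≤ K₁) (hl₁ : 0 ≤ l₁) {F : L2 Ω → L2v Ω → L2 Ω}
    (hFL : ∀ u v p q, ‖F u p - F v q‖ ≤ K₁ * ‖u - v‖ + l₁ * ‖p - q‖)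
    (cbar : ℝ → H10 Ω) (t r : ℝ) :
    ‖F (cbar t).fn (cbar t).grad - F (cbar r).fn (cbar r).grad‖ ≤
      (K₁ + l₁) * ‖cbar t - cbar r‖ := by
  have h1 := mul_le_mul_of_nonneg_left (H10.norm_fn_le (cbar t - cbar r)) hK₁
  have h2 := mul_le_mul_of_nonneg_left (H10.norm_grad_le (cbar t - cbar r)) hl₁
  rw [H10.fn_sub] at h1
  rw [H10.grad_sub] at h2
  linarith [hFL (cbar t).fn (cbar r).fn (cbar t).grad (cbar r).grad]

lemma continuousOn_comp {K₁ l₁ : ℝ} (hK₁ : 0 ≤ K₁) (hl₁ : 0 ≤ l₁) {L : ℝ}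
    (hL : 0 ≤ L) {F : L2 Ω → L2v Ω → L2 Ω}
    (hFL : ∀ u v p q, ‖F u p - F v q‖ ≤ K₁ * ‖u - v‖ + l₁ * ‖p - q‖) {cbar : ℝ → H10 Ω}
    (hlip : ∀ t ∈ Icc 0 T, ∀ r ∈ Icc 0 T, ‖cbar t - cbar r‖ ≤ L * |t - r|) :
    ContinuousOn (fun t => F (cbar t).fn (cbar t).grad) (Icc 0 T) := by
  refine (LipschitzOnWith.of_dist_le_mul (K := ((K₁ + l₁) * L).toNNReal)
    fun t ht r hr => ?_).continuousOn
  rw [dist_eq_norm, Real.dist_eq, Real.coe_toNNReal _ (by positivity), mul_assoc]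
  exact (norm_comp_sub_le hK₁ hl₁ hFL cbar t r).trans
    (mul_le_mul_of_nonneg_left (hlip t ht r hr) (by positivity))

lemma norm_sub_time_le {L : ℝ} (hL : 0 ≤ L) {cbar : ℝ → H10 Ω}
    (hlip : ∀ t ∈ Icc 0 T, ∀ r ∈ Icc 0 T, ‖cbar t - cbar r‖ ≤ L * |t - r|)
    {m : ℕ} (hm : m < D.N) {t : ℝ}
    (ht : t ∈ Icc (D.time m) (D.time (m + 1))) :
    ‖cbar t - cbar (D.time (m + 1))‖ ≤ L * D.dtMax := by
  have htb := D.time_mem (m := m + 1) hm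
  refine (hlip t ⟨(D.time_mem hm.le).1.trans ht.1, ht.2.trans htb.2⟩ _ htb).trans
    (mul_le_mul_of_nonneg_left ?_ hL)
  refine le_trans ?_ (D.dt_le_dtMax hm)
  rw [abs_sub_comm, abs_of_nonneg (by linarith [ht.2])]
  unfold dt
  linarith [ht.1]

/-- On one step the solution varies by at most L δt, and F of the solution by (K₁ + l₁) L δt. -/
lemma norm_averages_sub_le {K₁ l₁ : ℝ} (hK₁ : 0 ≤ K₁) (hl₁ : 0 ≤ l₁) {L : ℝ}
    (hL : 0 ≤ L) {F : L2 Ω → L2v Ω → L2 Ω}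
    (hFL : ∀ u v p q, ‖F u p - F v q‖ ≤ K₁ * ‖u - v‖ + l₁ * ‖p - q‖) {cbar : ℝ → H10 Ω}
    (hlip : ∀ t ∈ Icc 0 T, ∀ r ∈ Icc 0 T, ‖cbar t - cbar r‖ ≤ L * |t - r|)
    {m : ℕ} (hm : m < D.N) :
    ‖D.avgGrad cbar m - (cbar (D.time (m + 1))).grad‖ ≤ L * D.dtMax ∧
    ‖(D.dt m)⁻¹ • (∫ t in D.time m..D.time (m + 1), F (cbar t).fn (cbar t).grad) -
      F (cbar (D.time (m + 1))).fn (cbar (D.time (m + 1))).grad‖ ≤ (K₁ + l₁) * (L * D.dtMax) := by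
  have hta := D.time_mem hm.le
  have htb := D.time_mem (m := m + 1) hm
  have htlt := D.time_lt m hm
  have hIcc : Icc (D.time m) (D.time (m + 1)) ⊆ Icc 0 T := Icc_subset_Icc hta.1 htb.2
  have hcont := continuousOn_of_norm_sub_le hL hlip
  have hFcont := continuousOn_comp hK₁ hl₁ hL hFL hlip
  constructor
  · refine norm_average_sub_le htlt
      (continuous_h10_grad.comp_continuousOn (hcont.mono hIcc)) fun t ht => ?_
    exact (H10.norm_grad_le (cbar t - cbar (D.time (m + 1)))).trans
      (D.norm_sub_time_le hL hlip hm ht)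
  · refine norm_average_sub_le htlt (hFcont.mono hIcc) fun t ht => ?_
    exact (norm_comp_sub_le hK₁ hl₁ hFL cbar _ _).trans
      (mul_le_mul_of_nonneg_left (D.norm_sub_time_le hL hlip hm ht) (by positivity))

variable {D}

/-- Stability of one step of the scheme, tested with the discrete error. -/
lemma IsSchemeSolution.residual_le (hT : 0 < T) {lam K₁ l₁ L : ℝ}
    (hlam : 0 < lam) (hK₁ : 0 ≤ K₁) (hl₁ : 0 ≤ l₁) (hL : 0 ≤ L)
    {A : ℝ → E d → ℝ} {g f : ℝ → ℝ} {F : L2 Ω → L2v Ω → L2 Ω}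
    (hF : ∀ u p (h : L2 Ω), (∫ x in Ω, A (g (u x)) (p x) * h x) - ∫ x in Ω, f (u x) * h x
        = inner ℝ (F u p) h)
    (hFL : ∀ u v p q, ‖F u p - F v q‖ ≤ K₁ * ‖u - v‖ + l₁ * ‖p - q‖)
    {cbar : ℝ → H10 Ω} (hlip : ∀ t ∈ Icc 0 T, ∀ r ∈ Icc 0 T, ‖cbar t - cbar r‖ ≤ L * |t - r|)
    {c₀ : Linf Ω} {c : ℕ → D.X} (hc : D.IsSchemeSolution lam A g f c₀ c)
    {P Q : ℕ → D.X} {m : ℕ} (hm : m < D.N)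
    (hdiv : weakDiv (D.avgGrad cbar m) = lam⁻¹ • ((D.diffQuot cbar m).fn + (D.dt m)⁻¹ •
      ∫ t in D.time m..D.time (m + 1), F (cbar t).fn (cbar t).grad))
    (hPQ : P (m + 1) = P m + D.dt m • Q m) {σ : ℝ} (hσ : D.dtMax ≤ σ)
    (hQ : ‖D.recon (Q m) - (D.diffQuot cbar m).fn‖ ≤ D.stepError cbar m)
    (hP1 : ‖D.recon (P (m + 1)) - (cbar (D.time (m + 1))).fn‖ ≤ σ)
    (hP2 : ‖D.grad (P (m + 1)) - (cbar (D.time (m + 1))).grad‖ ≤ σ) :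
    inner ℝ ((D.dt m)⁻¹ • (D.recon (c (m + 1) - P (m + 1)) - D.recon (c m - P m)))
        (D.recon (c (m + 1) - P (m + 1))) + lam * ‖D.grad (c (m + 1) - P (m + 1))‖ ^ 2 ≤
      ((1 + lam) * D.stepError cbar m + (lam + K₁ + l₁) * (1 + L) * σ) *
        (‖D.recon (c (m + 1) - P (m + 1))‖ + ‖D.grad (c (m + 1) - P (m + 1))‖)
      + K₁ * ‖D.recon (c (m + 1) - P (m + 1))‖ ^ 2
      + l₁ * ‖D.recon (c (m + 1) - P (m + 1))‖ * ‖D.grad (c (m + 1) - P (m + 1))‖ := by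
  have hdt := D.dt_pos hm
  have hδ := D.dtMax_pos hT
  set Fbar : L2 Ω := (D.dt m)⁻¹ • ∫ t in D.time m..D.time (m + 1), F (cbar t).fn (cbar t).grad
    with hFbar
  obtain ⟨hgrad, hFb⟩ := D.norm_averages_sub_le hK₁ hl₁ hL hFL hlip hm
  set φ : D.X := c (m + 1) - P (m + 1) with hφ
  set q : L2 Ω := (D.diffQuot cbar m).fn with hq
  set u : L2 Ω := D.recon (c (m + 1)) with hu
  set p : L2v Ω := D.grad (c (m + 1)) with hp
  set a := ‖D.recon φ‖ with ha
  set b := ‖D.grad φ‖ with hb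
  have hscheme : inner ℝ ((D.dt m)⁻¹ • (u - D.recon (c m))) (D.recon φ) + lam * inner ℝ p (D.grad φ)
      + inner ℝ (F u p) (D.recon φ) = 0 := by
    have h1 := hc.step m hm φ
    have h2 := hF u p (D.recon φ)
    linarith
  have hsplit : (D.dt m)⁻¹ • (D.recon φ - D.recon (c m - P m)) =
      (D.dt m)⁻¹ • (u - D.recon (c m)) - D.recon (Q m) := by
    have : D.recon φ - D.recon (c m - P m) = (u - D.recon (c m)) - D.dt m • D.recon (Q m) := by
      rw [hφ, hPQ, map_sub, map_sub, map_add, map_smul]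
      abel
    rw [this, smul_sub, smul_smul, inv_mul_cancel₀ hdt.ne', one_smul]
  have hgg : b ^ 2 = inner ℝ p (D.grad φ) - inner ℝ (D.grad (P (m + 1))) (D.grad φ) := by
    rw [hb, ← real_inner_self_eq_norm_sq, ← inner_sub_left, hp, ← map_sub]
  have hW := D.abs_le_WD_mul (D.avgGrad cbar m) φ
  have hWle : D.WD (D.avgGrad cbar m) ≤ D.stepError cbar m := by
    have h2 := D.SD_nonneg (cbar (D.time (m + 1)))
    have h4 := D.SD_nonneg (D.diffQuot cbar m)
    unfold stepError
    linarith
  have hμ := D.stepError_nonneg hT cbar m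
  set μ := D.stepError cbar m with hμdef
  rw [hdiv, real_inner_smul_right, real_inner_comm, real_inner_comm (q + Fbar)] at hW
  -- The tested scheme split into its four defects. The last one is the expression bounded by W_D,
  -- and the weight λ cancels the λ⁻¹ in the divergence, so that `q` and `Fbar` compensate those
  -- subtracted elsewhere.
  have hid : inner ℝ ((D.dt m)⁻¹ • (D.recon φ - D.recon (c m - P m))) (D.recon φ) + lam * b ^ 2 =
      -inner ℝ (D.recon (Q m) - q) (D.recon φ)
      - lam * inner ℝ (D.grad (P (m + 1)) - D.avgGrad cbar m) (D.grad φ)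
      - inner ℝ (F u p - Fbar) (D.recon φ)
      - lam * (inner ℝ (D.avgGrad cbar m) (D.grad φ) + lam⁻¹ * inner ℝ (q + Fbar) (D.recon φ)) := by
    rw [hsplit, hgg]
    simp only [inner_sub_left, inner_add_left] at hscheme ⊢
    have : lam * (lam⁻¹ * (inner ℝ q (D.recon φ) + inner ℝ Fbar (D.recon φ))) =
      inner ℝ q (D.recon φ) + inner ℝ Fbar (D.recon φ) := by field_simp
    linarith
  have b1 : -inner ℝ (D.recon (Q m) - q) (D.recon φ) ≤ μ * a :=
    (neg_le_abs _).trans ((abs_real_inner_le_norm _ _).trans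
      (mul_le_mul_of_nonneg_right hQ (norm_nonneg _)))
  have b2 : -inner ℝ (D.grad (P (m + 1)) - D.avgGrad cbar m) (D.grad φ) ≤ (σ + L * D.dtMax) * b := by
    refine (neg_le_abs _).trans ((abs_real_inner_le_norm _ _).trans
      (mul_le_mul_of_nonneg_right ?_ (norm_nonneg _)))
    have := norm_sub_le_norm_sub_add_norm_sub (D.grad (P (m + 1)))
      (cbar (D.time (m + 1))).grad (D.avgGrad cbar m)
    rw [norm_sub_rev (cbar (D.time (m + 1))).grad] at this
    linarith
  have b3 : -inner ℝ (F u p - Fbar) (D.recon φ) ≤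
      (K₁ * (a + σ) + l₁ * (b + σ) + (K₁ + l₁) * (L * D.dtMax)) * a := by
    refine (neg_le_abs _).trans ((abs_real_inner_le_norm _ _).trans
      (mul_le_mul_of_nonneg_right ?_ (norm_nonneg _)))
    have h1 := norm_sub_le_norm_sub_add_norm_sub (F u p)
      (F (cbar (D.time (m + 1))).fn (cbar (D.time (m + 1))).grad) Fbar
    have hFb' := hFb
    rw [norm_sub_rev] at hFb'
    have h2 := hFL u (cbar (D.time (m + 1))).fn p (cbar (D.time (m + 1))).grad
    have h3 : ‖u - (cbar (D.time (m + 1))).fn‖ ≤ a + σ := by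
      have := norm_sub_le_norm_sub_add_norm_sub u (D.recon (P (m + 1)))
        (cbar (D.time (m + 1))).fn
      rw [hu, ← map_sub] at this
      exact this.trans (add_le_add le_rfl hP1)
    have h4 : ‖p - (cbar (D.time (m + 1))).grad‖ ≤ b + σ := by
      have := norm_sub_le_norm_sub_add_norm_sub p (D.grad (P (m + 1)))
        (cbar (D.time (m + 1))).grad
      rw [hp, ← map_sub] at this
      exact this.trans (add_le_add le_rfl hP2)
    have h5 := mul_le_mul_of_nonneg_left h3 hK₁
    have h6 := mul_le_mul_of_nonneg_left h4 hl₁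
    linarith
  have b4 : -(inner ℝ (D.avgGrad cbar m) (D.grad φ) + lam⁻¹ * inner ℝ (q + Fbar) (D.recon φ))
      ≤ μ * b :=
    (neg_le_abs _).trans (hW.trans (mul_le_mul_of_nonneg_right hWle (norm_nonneg _)))
  rw [hid]
  have := residual_arith hlam.le hK₁ hl₁ hL hδ.le hσ hμ (norm_nonneg (D.recon φ))
    (norm_nonneg (D.grad φ)) b1 b2 b3 b4
  linarith

end GradDisc

end GDM

/-! ### The discrete error estimate -/

namespace GDM

namespace GradDisc

variable {d : ℕ} {Ω : Set (E d)} {T : ℝ} {D : GradDisc Ω T}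

/-- The discrete error estimate between a solution of the scheme and interpolants of the
weak solution. -/
lemma IsSchemeSolution.error_estimate [IsFiniteMeasure (volume.restrict Ω)] (hΩ : IsOpen Ω)
    (hT : 0 < T) {lam K₁ l₁ L K : ℝ}
    (hlam : 0 < lam) (hK₁ : 0 ≤ K₁) (hl₁ : 0 ≤ l₁) (hL : 0 ≤ L)
    (hK : K = K₁ + l₁ ^ 2 / lam + 1 / 2)
    {A : ℝ → E d → ℝ} {g f : ℝ → ℝ} {F : L2 Ω → L2v Ω → L2 Ω}
    (hF : ∀ u p (h : L2 Ω), (∫ x in Ω, A (g (u x)) (p x) * h x) - ∫ x in Ω, f (u x) * h x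
        = inner ℝ (F u p) h)
    (hFL : ∀ u v p q, ‖F u p - F v q‖ ≤ K₁ * ‖u - v‖ + l₁ * ‖p - q‖)
    {c₀ : L2 Ω} {cbar : ℝ → H10 Ω} (hsol : IsWeakSolution Ω T lam A g f c₀ cbar)
    (hlip : ∀ t ∈ Icc 0 T, ∀ r ∈ Icc 0 T, ‖cbar t - cbar r‖ ≤ L * |t - r|)
    {c₀b : Linf Ω} {c : ℕ → D.X} (hc : D.IsSchemeSolution lam A g f c₀b c)
    (hdt : ∀ m < D.N, 2 * K * D.dt m ≤ 1 / 2) {B : ℝ}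
    (hB : B = D.dtMax + D.SD (cbar 0) + ‖c₀ - D.recon (D.interp c₀b)‖ + D.MD cbar) :
    ∃ P : ℕ → D.X,
      (∀ m ≤ D.N, ‖D.recon (P m) - (cbar (D.time m)).fn‖ ≤ (1 + √T) * B ∧
        ‖D.grad (P m) - (cbar (D.time m)).grad‖ ≤ (1 + √T) * B) ∧
      ∀ m ≤ D.N, ‖D.recon (c m - P m)‖ ^ 2
          + lam * ∑ j ∈ Finset.range m, D.dt j * ‖D.grad (c (j + 1) - P (j + 1))‖ ^ 2 ≤
        Real.exp (4 * K * T) * (1 + 2 * (1 / lam + 1 / 2) * (2 * (1 + lam) ^ 2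
          + 2 * ((lam + K₁ + l₁) * (1 + L) * (1 + √T)) ^ 2 * T)) * B ^ 2 := by
  obtain ⟨P, Q, hPQ, hQ, hP0, hP⟩ := D.exists_interpolants hT cbar
  have hδ := D.dtMax_pos hT
  have hS := D.SD_nonneg (cbar 0)
  have hM := D.MD_nonneg cbar
  have hJ := norm_nonneg (c₀ - D.recon (D.interp c₀b))
  have hsT := Real.sqrt_nonneg T
  have hK0 : 0 ≤ K := by rw [hK]; positivity
  have hB0 : 0 ≤ B := by rw [hB]; positivity
  have hσB : D.SD (cbar 0) + D.dtMax + √T * D.MD cbar ≤ (1 + √T) * B := by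
    have h1 : √T * D.MD cbar ≤ √T * B := mul_le_mul_of_nonneg_left (by linarith) hsT
    linarith
  have hδσ : D.dtMax ≤ (1 + √T) * B := by
    have : 0 ≤ √T * D.MD cbar := by positivity
    linarith
  have hPB : ∀ m ≤ D.N, ‖D.recon (P m) - (cbar (D.time m)).fn‖ ≤ (1 + √T) * B ∧
      ‖D.grad (P m) - (cbar (D.time m)).grad‖ ≤ (1 + √T) * B := fun m hm =>
    ⟨(hP m hm).1.trans hσB, (hP m hm).2.trans hσB⟩
  refine ⟨P, hPB, fun m hm => ?_⟩
  have hcont := continuousOn_of_norm_sub_le hL hlip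
  have hFcont := continuousOn_comp hK₁ hl₁ hL hFL hlip
  obtain ⟨α, hα⟩ : ∃ α, α = 1 + lam := ⟨_, rfl⟩
  obtain ⟨β, hβ⟩ : ∃ β, β = (lam + K₁ + l₁) * (1 + L) * (1 + √T) := ⟨_, rfl⟩
  rw [← hα, ← hβ]
  -- The coefficient of the linear part of the residual: the step errors sum in square to M_D²,
  -- while the constant `β * B` contributes the factor T.
  let r : ℕ → ℝ := fun m => α * D.stepError cbar m + β * B
  have hstep : ∀ m < D.N, ‖D.recon (c (m + 1) - P (m + 1))‖ ^ 2 - ‖D.recon (c m - P m)‖ ^ 2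
      + lam * D.dt m * ‖D.grad (c (m + 1) - P (m + 1))‖ ^ 2 ≤
      2 * K * D.dt m * ‖D.recon (c (m + 1) - P (m + 1))‖ ^ 2
        + D.dt m * (2 * (1 / lam + 1 / 2) * r m ^ 2) := by
    intro m hm
    have hdiv := weakDiv_eq hΩ (hsol.isWeakDiv_average hT hlam hcont hF hFcont
      (D.time_mem hm.le) (D.time_mem (m := m + 1) hm))
    have hres := hc.residual_le hT hlam hK₁ hl₁ hL hF hFL hlip hm hdiv (hPQ m) hδσ (hQ m)
      (hPB (m + 1) hm).1 (hPB (m + 1) hm).2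
    rw [← hα, show (lam + K₁ + l₁) * (1 + L) * ((1 + √T) * B) = β * B by rw [hβ]; ring] at hres
    rw [hK]
    exact implicit_energy_step (D.dt_pos hm) hlam rfl hres
  have hgron := implicit_gronwall (N := D.N) (a := fun m => ‖D.recon (c m - P m)‖ ^ 2)
    (b := fun m => ‖D.grad (c m - P m)‖ ^ 2) (τ := D.dt)
    (ρ := fun m => 2 * (1 / lam + 1 / 2) * r m ^ 2) hK0 hlam.le (fun m => by positivity)
    (fun m => by positivity) (fun m => by positivity) (fun m hm => (D.dt_pos hm).le) hdt hstep m hm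
  refine hgron.trans ?_
  -- Passing through c₀ splits the initial error into the error of the interpolated datum and that
  -- of `P 0`, which together are at most B.
  have h0 : ‖D.recon (c 0 - P 0)‖ ^ 2 ≤ B ^ 2 := by
    refine pow_le_pow_left₀ (norm_nonneg _) ?_ 2
    rw [hc.initial, map_sub]
    have h1 := norm_sub_le_norm_sub_add_norm_sub (D.recon (D.interp c₀b)) c₀ (D.recon (P 0))
    rw [norm_sub_rev _ c₀, norm_sub_rev c₀ (D.recon (P 0))] at h1
    rw [hsol.initial] at hP0
    linarith
  have hsum : ∑ j ∈ Finset.range m, D.dt j * (2 * (1 / lam + 1 / 2) * r j ^ 2) ≤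
      2 * (1 / lam + 1 / 2) * (2 * α ^ 2 + 2 * β ^ 2 * T) * B ^ 2 := by
    calc _ ≤ ∑ j ∈ Finset.range D.N, D.dt j * (2 * (1 / lam + 1 / 2) * r j ^ 2) :=
          Finset.sum_le_sum_of_subset_of_nonneg (Finset.range_mono hm) fun j hj _ =>
            mul_nonneg (D.dt_pos (Finset.mem_range.1 hj)).le (by positivity)
      _ ≤ ∑ j ∈ Finset.range D.N, 2 * (1 / lam + 1 / 2) *
            (2 * α ^ 2 * (D.dt j * D.stepError cbar j ^ 2) + 2 * (β * B) ^ 2 * D.dt j) := by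
          refine Finset.sum_le_sum fun j hj => ?_
          have h1 := (D.dt_pos (Finset.mem_range.1 hj)).le
          have h2 : r j ^ 2 ≤ 2 * (α * D.stepError cbar j) ^ 2 + 2 * (β * B) ^ 2 := by
            have := sq_nonneg (α * D.stepError cbar j - β * B)
            simp only [r]
            linarith
          have h3 : 0 ≤ D.dt j * (2 * (1 / lam + 1 / 2)) := by positivity
          linarith [mul_le_mul_of_nonneg_left h2 h3]
      _ = 2 * (1 / lam + 1 / 2) * (2 * α ^ 2 * D.MD cbar ^ 2 + 2 * (β * B) ^ 2 * T) := by
          rw [← Finset.mul_sum, Finset.sum_add_distrib, ← Finset.mul_sum, ← Finset.mul_sum,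
            D.sum_stepError_sq, (D.sum_dt D.N).trans D.time_last]
      _ ≤ 2 * (1 / lam + 1 / 2) * (2 * α ^ 2 * B ^ 2 + 2 * (β * B) ^ 2 * T) := by
          have : D.MD cbar ≤ B := by linarith
          gcongr
      _ = _ := by ring
  have hexp : Real.exp (4 * K * ∑ j ∈ Finset.range m, D.dt j) ≤ Real.exp (4 * K * T) := by
    rw [D.sum_dt]
    have := (D.time_mem hm).2
    gcongr
  calc _ ≤ Real.exp (4 * K * T) * (B ^ 2
        + 2 * (1 / lam + 1 / 2) * (2 * α ^ 2 + 2 * β ^ 2 * T) * B ^ 2) := by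
        refine mul_le_mul hexp (add_le_add h0 hsum) ?_ (Real.exp_pos _).le
        refine add_nonneg (by positivity) (Finset.sum_nonneg fun j hj => ?_)
        exact mul_nonneg (D.dt_pos (lt_of_lt_of_le (Finset.mem_range.1 hj) hm)).le (by positivity)
    _ = _ := by ring

end GradDisc

end GDM

/-! ### The theorem -/

open MeasureTheory Set GDM in
theorem theorem3p1 (lam l₁ l₂ l₃ : ℝ) (hlam : 0 < lam) (hl₁ : 0 < l₁) (hl₂ : 0 < l₂)
    (hl₃ : 0 < l₃) :
    ∃ ε : ℝ, 0 < ε ∧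
    ∀ (d : ℕ) (_ : 1 < d) (Ω : Set (E d)) (_ : IsOpen Ω) (_ : Bornology.IsBounded Ω)
      (_ : IsConnected Ω) (T : ℝ) (_ : 0 < T)
      (A : ℝ → E d → ℝ)
      (_ : ∀ r s : ℝ, ∀ p q : E d, |A r p - A s q| ≤ l₁ * (|r - s| + ‖p - q‖))
      (g : ℝ → ℝ) (_ : ∀ r s : ℝ, |g r - g s| ≤ l₂ * |r - s|)
      (f : ℝ → ℝ) (_ : ∀ r s : ℝ, |f r - f s| ≤ l₃ * |r - s|)
      (c₀ : L2 Ω) (c₀b : Linf Ω) (_ : c₀b =ᵐ[volume.restrict Ω] c₀)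
      (cbar : ℝ → H10 Ω) (_ : IsWeakSolution Ω T lam A g f c₀ cbar)
      (_ : IsW1infW2inf Ω T cbar),
    ∃ C₁ C₂ : ℝ, 0 < C₁ ∧ 0 < C₂ ∧
    ∀ (D : GradDisc Ω T) (_ : ∀ m < D.N, D.dt m < 2 * lam / (D.CD + ε))
      (c : ℕ → D.X) (_ : D.IsSchemeSolution lam A g f c₀b c),
      (∀ k : ℕ, 1 ≤ k → k ≤ D.N →
        eLpNorm (fun t => D.stepFn (fun m => D.recon (c m)) t - (cbar t).fn) ∞ (timeMeasure T)
          ≤ ENNReal.ofReal (C₁ * (D.dtMax + D.SD (cbar 0) + ‖c₀ - D.recon (D.interp c₀b)‖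
              + D.MD cbar) + Real.sqrt 2 * D.SD (cbar (D.time k)))) ∧
      eLpNorm (fun t => D.stepFn (fun m => D.grad (c m)) t - (cbar t).grad) 2 (timeMeasure T)
        ≤ ENNReal.ofReal (C₂ * (D.dtMax + D.SD (cbar 0) + ‖c₀ - D.recon (D.interp c₀b)‖
            + D.MD cbar)
          + Real.sqrt 2 * ∑ m ∈ Finset.range D.N, D.dt m * D.SD (cbar (D.time (m + 1)))) := by
  obtain ⟨K, hK⟩ : ∃ K, K = l₁ * l₂ + l₃ + l₁ ^ 2 / lam + 1 / 2 := ⟨_, rfl⟩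
  have hK0 : 0 < K := by rw [hK]; positivity
  -- As C_D ≥ 0, the step condition gives δt < 2λ / (8Kλ) = 1 / (4K), which is what Gronwall's
  -- inequality requires.
  refine ⟨8 * K * lam, by positivity, ?_⟩
  intro d _ Ω hΩ hΩb _ T hT A hA g hg f hf c₀ c₀b _ cbar hsol hreg
  have : IsFiniteMeasure (volume.restrict Ω) :=
    isFiniteMeasure_restrict.2 hΩb.measure_lt_top.ne
  obtain ⟨F, hF, hFL⟩ := exists_nemytskii (Ω := Ω) hl₁.le hl₂.le hl₃.le hA hg hf
  obtain ⟨L, hL, hlip⟩ := hreg.exists_lipschitz hΩ hT hsol.continuousOn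
  obtain ⟨R, hR⟩ : ∃ R, R = Real.exp (4 * K * T) * (1 + 2 * (1 / lam + 1 / 2) * (2 * (1 + lam) ^ 2
    + 2 * ((lam + (l₁ * l₂ + l₃) + l₁) * (1 + L) * (1 + √T)) ^ 2 * T)) := ⟨_, rfl⟩
  have hR0 : 0 < R := by rw [hR]; positivity
  have hsT := Real.sqrt_nonneg T
  -- The three parts of C₁ are the discrete error, the interpolation error and the variation within
  -- a step. In C₂ the first part is R / λ, from the accumulated diffusion, and both 2's come from
  -- (x + y)² ≤ 2x² + 2y².
  refine ⟨√R + (1 + √T) + L, √(2 * (R / lam) + 2 * T * ((1 + √T) + L) ^ 2), by positivity,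
    Real.sqrt_pos.2 (by positivity), ?_⟩
  intro D hdt c hc
  have hdtK : ∀ m < D.N, 2 * K * D.dt m ≤ 1 / 2 := by
    intro m hm
    have h1 := hdt m hm
    rw [lt_div_iff₀ (by have := D.CD_nonneg; positivity)] at h1
    have h2 : 0 ≤ D.dt m * D.CD := mul_nonneg (D.dt_pos hm).le D.CD_nonneg
    have h3 : lam * (4 * K * D.dt m) < lam * 1 := by linarith
    linarith [lt_of_mul_lt_mul_left h3 hlam.le]
  obtain ⟨B, hB⟩ : ∃ B, B = D.dtMax + D.SD (cbar 0) + ‖c₀ - D.recon (D.interp c₀b)‖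
    + D.MD cbar := ⟨_, rfl⟩
  rw [← hB]
  have hδ := D.dtMax_pos hT
  have hδB : D.dtMax ≤ B := by
    linarith [D.SD_nonneg (cbar 0), D.MD_nonneg cbar, norm_nonneg (c₀ - D.recon (D.interp c₀b))]
  have hB0 : 0 ≤ B := hδ.le.trans hδB
  obtain ⟨P, hP, hE⟩ := hc.error_estimate hΩ hT hlam (by positivity) hl₁.le hL hK hF hFL hsol hlip
    hdtK hB
  simp only [← hR] at hE
  have hsumnn : ∀ m ≤ D.N, 0 ≤ ∑ j ∈ Finset.range m,
      D.dt j * ‖D.grad (c (j + 1) - P (j + 1))‖ ^ 2 := fun m hm => Finset.sum_nonneg fun j hj =>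
    mul_nonneg (D.dt_pos (lt_of_lt_of_le (Finset.mem_range.1 hj) hm)).le (by positivity)
  have hLB : L * D.dtMax ≤ L * B := mul_le_mul_of_nonneg_left hδB hL
  constructor
  · intro k _ _
    refine (eLpNorm_le_of_ae_bound (C := (√R + (1 + √T) + L) * B) ?_).trans ?_
    · filter_upwards [ae_restrict_mem measurableSet_Ioo] with t ht
      obtain ⟨m, hm, htm⟩ := D.exists_mem_Ioc ht
      rw [D.stepFn_eq _ hm htm]
      have h1 := D.norm_sub_time_le hL hlip hm (Ioc_subset_Icc_self htm)
      have h2 : ‖D.recon (c (m + 1) - P (m + 1))‖ ≤ √R * B := by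
        refine abs_le_of_sq_le_sq' ?_ (by positivity) |>.2
        rw [mul_pow, Real.sq_sqrt hR0.le]
        have := mul_nonneg hlam.le (hsumnn (m + 1) hm)
        linarith [hE (m + 1) hm]
      have h3 := (hP (m + 1) hm).1
      have h4 := H10.norm_fn_le (cbar t - cbar (D.time (m + 1)))
      rw [H10.fn_sub] at h4
      have e : D.recon (c (m + 1)) - (cbar t).fn = D.recon (c (m + 1) - P (m + 1))
          + (D.recon (P (m + 1)) - (cbar (D.time (m + 1))).fn)
          - ((cbar t).fn - (cbar (D.time (m + 1))).fn) := by rw [map_sub]; abel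
      rw [e]
      refine (norm_sub_le _ _).trans ?_
      have h5 := norm_add_le (D.recon (c (m + 1) - P (m + 1)))
        (D.recon (P (m + 1)) - (cbar (D.time (m + 1))).fn)
      linarith
    · simp only [ENNReal.toReal_top, inv_zero, ENNReal.rpow_zero, one_mul]
      refine ENNReal.ofReal_le_ofReal ?_
      have := mul_nonneg (Real.sqrt_nonneg 2) (D.SD_nonneg (cbar (D.time k)))
      linarith
  · have hS : 0 ≤ √2 * ∑ m ∈ Finset.range D.N, D.dt m * D.SD (cbar (D.time (m + 1))) :=
      mul_nonneg (Real.sqrt_nonneg 2) (Finset.sum_nonneg fun m hm =>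
        mul_nonneg (D.dt_pos (Finset.mem_range.1 hm)).le (D.SD_nonneg _))
    refine le_trans ?_ (ENNReal.ofReal_le_ofReal (le_add_of_nonneg_right hS))
    refine D.eLpNorm_two_le (β := fun m => ‖D.grad (c (m + 1) - P (m + 1))‖
      + ((1 + √T) + L) * B) (by positivity) ?_ ?_
    · intro m hm t ht htm
      rw [D.stepFn_eq _ hm htm]
      have h1 := D.norm_sub_time_le hL hlip hm (Ioc_subset_Icc_self htm)
      have h3 := (hP (m + 1) hm).2
      have h4 := H10.norm_grad_le (cbar t - cbar (D.time (m + 1)))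
      rw [H10.grad_sub] at h4
      have e : D.grad (c (m + 1)) - (cbar t).grad = D.grad (c (m + 1) - P (m + 1))
          + (D.grad (P (m + 1)) - (cbar (D.time (m + 1))).grad)
          - ((cbar t).grad - (cbar (D.time (m + 1))).grad) := by rw [map_sub]; abel
      rw [e]
      refine (norm_sub_le _ _).trans ?_
      have h5 := norm_add_le (D.grad (c (m + 1) - P (m + 1)))
        (D.grad (P (m + 1)) - (cbar (D.time (m + 1))).grad)
      linarith
    · rw [mul_pow, Real.sq_sqrt (by positivity)]
      calc _ ≤ ∑ m ∈ Finset.range D.N, (2 * (D.dt m * ‖D.grad (c (m + 1) - P (m + 1))‖ ^ 2)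
            + 2 * (((1 + √T) + L) * B) ^ 2 * D.dt m) := by
            refine Finset.sum_le_sum fun m hm => ?_
            have h1 := mul_nonneg (D.dt_pos (Finset.mem_range.1 hm)).le
              (sq_nonneg (‖D.grad (c (m + 1) - P (m + 1))‖ - ((1 + √T) + L) * B))
            linarith
        _ = 2 * (∑ m ∈ Finset.range D.N, D.dt m * ‖D.grad (c (m + 1) - P (m + 1))‖ ^ 2)
            + 2 * (((1 + √T) + L) * B) ^ 2 * T := by
            rw [Finset.sum_add_distrib, ← Finset.mul_sum, ← Finset.mul_sum,
              (D.sum_dt D.N).trans D.time_last]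
        _ ≤ 2 * (R / lam * B ^ 2) + 2 * (((1 + √T) + L) * B) ^ 2 * T := by
            gcongr
            rw [div_mul_eq_mul_div, le_div_iff₀ hlam]
            linarith [hE D.N le_rfl, sq_nonneg ‖D.recon (c D.N - P D.N)‖]
        _ = _ := by ring
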